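/- Let $m\ge 2$ and let $\mathbb{R}_m=C\ell_{0,m}$ be the real Clifford algebra generated by $e_1,\dots,e_m$ with $e_j^2=-1$ and $e_je_k=-e_ke_j$ for $j\ne k$, identified with $\mathbb{R}^{2^m}$. Let $\mathbb{R}^{m+1}\subset\mathbb{R}_m$ be the space of paravectors $x=x_0+\sum_{j=1}^m x_je_j$, and put $\mathrm{Im}(x)=\sum_{j=1}^m x_je_j$, $\overline{x}=x_0-\mathrm{Im}(x)$, $|\mathrm{Im}(x)|=(\sum_{j=1}^m x_j^2)^{1/2}$. Let $\mathbb{S}^{m-1}=\{I\in\mathbb{R}^{m+1}: I^2=-1\}$ and, for $I\in\mathbb{S}^{m-1}$, let $\mathbb{C}_I=\{\alpha+I\beta:\alpha,\beta\in\mathbb{R}\}$ and $\phi_I(\alpha+i\beta)=\alpha+I\beta$. Let $\Omega\subset\mathbb{R}^{m+1}$ be a non-empty connected open set with $\Omega\cap\mathbb{R}\neq\emptyset$ that is circular, i.e. $\Omega=\{\alpha+I\beta:\alpha+i\beta\in E,\ I\in\mathbb{S}^{m-1}\}$ for some $E\subset\mathbb{C}$. Let $D$ be the set of all $\alpha+i\beta\in\mathbb{C}$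 such that $\alpha+I\beta\in\Omega$ for some (equivalently, every) $I\in\mathbb{S}^{m-1}$. Put $\Omega_I=\Omega\cap\mathbb{C}_I$, $\Omega_*=\Omega\setminus\mathbb{R}$, and for $f:\Omega\to\mathbb{R}_m$ write $f_I=f|_{\Omega_I}$, $f_*=f|_{\Omega_*}$. For $g:\Omega_I\to\mathbb{R}_m$ with $g\circ\phi_I$ of class $\mathscr{C}^n$ on $D$, let $$\overline{\partial}_I^{\,n}g(x)=\frac{1}{2^n}\Big(\Big(\frac{\partial}{\partial\alpha}+I\frac{\partial}{\partial\beta}\Big)^n(g\circ\phi_I)\Big)(\phi_I^{-1}(x)).$$ On functions $\Omega_*\to\mathbb{R}_m$ of class $\mathscr{C}^1$ let $$\overline{\vartheta}_m=\frac12\Big(\frac{\partial}{\partial x_0}+\frac{\mathrm{Im}(x)}{|\mathrm{Im}(x)|^2}\sum_{h=1}^m x_h\frac{\partial}{\partial x_h}\Big),$$ and let $\overline{\vartheta}_m^{\,n}$ be its $n$-th power, defined on functions of class $\mathscr{C}^n$. A stem function is a function $F=F_1+iF_2:D\to\mathbb{R}_m\otimes_{\mathbb{R}}\mathbb{C}$,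 $F_1,F_2:D\to\mathbb{R}_m$, with $F_1(\overline z)=F_1(z)$ and $F_2(\overline z)=-F_2(z)$ for all $z\in D$. It induces the slice function $\mathcal{I}(F):\Omega\to\mathbb{R}_m$, $\mathcal{I}(F)(\alpha+I\beta)=F_1(\alpha+i\beta)+I\,F_2(\alpha+i\beta)$ for all $\alpha+i\beta\in D$ and $I\in\mathbb{S}^{m-1}$; $F$ is uniquely determined by $\mathcal{I}(F)$. For $k\ge 0$ let $\mathcal{S}^k(\Omega,\mathbb{R}_m)$ be the set of slice functions induced by stem functions of class $\mathscr{C}^k$ ($\mathscr{C}^0$ meaning continuous). If $f=\mathcal{I}(F)\in\mathcal{S}^n(\Omega,\mathbb{R}_m)$ with $F$ of class $\mathscr{C}^n$, let $\big(\frac{\partial}{\partial x^c}\big)^nf=\mathcal{I}\big(\frac{\partial^nF}{\partial\overline z^n}\big)$, where $\frac{\partial F}{\partial\overline z}=\frac12\big(\frac{\partial F}{\partial\alpha}+i\frac{\partial F}{\partial\beta}\big)$. A function $g:\Omega\to\mathbb{R}_m$ is slice monogenic if it is of class $\mathscr{C}^1$ and $\overline{\partial}_I g_I=0$ on $\Omega_I$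 for all $I\in\mathbb{S}^{m-1}$. A function $f:\Omega\to\mathbb{R}_m$ is global slice polymonogenic of order $n$ if there are slice monogenic functions $f_0,\dots,f_{n-1}:\Omega\to\mathbb{R}_m$ with $f(x)=\sum_{h=0}^{n-1}\overline{x}^hf_h(x)$ for all $x\in\Omega$. **Theorem.** Let $n\ge1$ be an integer and let $f:\Omega\to\mathbb{R}_m$ be a function. The following assertions are equivalent. - (a) $f$ is global slice polymonogenic of order $n$. - (b) $f\in\mathcal{S}^{n-1}(\Omega,\mathbb{R}_m)$, $f_*$ is of class $\mathscr{C}^n$ on $\Omega_*$, and $\overline{\vartheta}_m^{\,n}f_*=0$ on $\Omega_*$. - (c) $f\in\mathcal{S}^{n}(\Omega,\mathbb{R}_m)$ and $\overline{\partial}_I^{\,n}f_I=0$ on $\Omega_I$ for all $I\in\mathbb{S}^{m-1}$. - (c') $f\in\mathcal{S}^{n}(\Omega,\mathbb{R}_m)$ and $\overline{\vartheta}_m^{\,n}f_*=0$ on $\Omega_*$. - (c'') $f\in\mathcal{S}^{n}(\Omega,\mathbb{R}_m)$ and $\big(\frac{\partial}{\partial x^c}\big)^nf=0$ on $\Omega$.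 -/

import Mathlib

namespace SliceClifford

noncomputable section

/-! ### The Clifford algebra `ℝ_m = Cl(0, m)` and its Euclidean topology -/

/-- The negative definite quadratic form `v ↦ -(v₁² + ⋯ + v_m²)` on `ℝ^m`. -/
def negForm (m : ℕ) : QuadraticForm ℝ (Fin m → ℝ) :=
  QuadraticMap.weightedSumSquares ℝ (fun _ : Fin m => (-1 : ℝ))

/-- The Clifford algebra `ℝ_m = Cl(0, m)`, in which `e_j ^ 2 = -1`. -/
abbrev Cl (m : ℕ) : Type := CliffordAlgebra (negForm m)

/-- The standard basis `(e_K)`, indexed by the subsets `K` of `{1, …, m}`: the basis of exterior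
products, transported by the canonical linear isomorphism. The lemma `clBasis_apply` below shows
that `e_K` is the product in `ℝ_m` of the `e_j`, `j ∈ K`, in increasing order. -/
def clBasis (m : ℕ) : Module.Basis (Finset (Fin m)) ℝ (Cl m) :=
  ((Pi.basisFun ℝ (Fin m)).ExteriorAlgebra).map (CliffordAlgebra.equivExterior (negForm m)).symm

theorem contract_prod {m : ℕ} (Q : QuadraticForm ℝ (Fin m → ℝ))
    (d : Module.Dual ℝ (Fin m → ℝ)) (l : List (Fin m → ℝ)) (h : ∀ w ∈ l, d w = 0) :
    CliffordAlgebra.contractLeft (Q := Q) d ((l.map (CliffordAlgebra.ι Q)).prod) = 0 := by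
  induction l with
  | nil => simp
  | cons w l ih =>
    rw [List.map_cons, List.prod_cons, CliffordAlgebra.contractLeft_ι_mul,
      ih fun u hu => h u (List.mem_cons_of_mem _ hu), h w List.mem_cons_self]
    simp

theorem equivExterior_prod {m : ℕ} (l : List (Fin m)) (hl : l.Nodup) :
    CliffordAlgebra.equivExterior (negForm m)
      (((l.map fun j => (Pi.single j (1 : ℝ) : Fin m → ℝ)).map
        (CliffordAlgebra.ι (negForm m))).prod) =
      ((l.map fun j => (Pi.single j (1 : ℝ) : Fin m → ℝ)).map
        (CliffordAlgebra.ι (0 : QuadraticForm ℝ (Fin m → ℝ)))).prod := by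
  simp only [CliffordAlgebra.equivExterior, CliffordAlgebra.changeFormEquiv_apply]
  induction l with
  | nil => simp
  | cons j l ih =>
    obtain ⟨hj, hl'⟩ := List.nodup_cons.1 hl
    rw [List.map_cons, List.map_cons, List.prod_cons, CliffordAlgebra.changeForm_ι_mul, ih hl',
      List.map_cons, List.prod_cons, contract_prod, sub_zero]
    intro w hw
    obtain ⟨k, hk, rfl⟩ := List.mem_map.1 hw
    have hjk : j ≠ k := fun h => hj (h ▸ hk)
    have h0 : ∀ i : Fin m, (Pi.single j (1 : ℝ) : Fin m → ℝ) i *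
        (Pi.single k (1 : ℝ) : Fin m → ℝ) i = 0 := fun i => by
      by_cases h : i = j
      · subst h; simp [hjk]
      · simp [h]
    have h0' : ∀ i : Fin m, (Pi.single k (1 : ℝ) : Fin m → ℝ) i *
        (Pi.single j (1 : ℝ) : Fin m → ℝ) i = 0 := fun i => by rw [mul_comm, h0]
    rw [QuadraticMap.associated_apply]
    simp [negForm, add_mul, mul_add, Finset.sum_add_distrib, h0, h0']

theorem clBasis_apply (m : ℕ) (K : Finset (Fin m)) :
    clBasis m K = ((K.sort (· ≤ ·)).map fun j =>
      CliffordAlgebra.ι (negForm m) (Pi.single j (1 : ℝ))).prod := by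
  have h := equivExterior_prod (K.sort (· ≤ ·)) (K.sort_nodup _)
  rw [List.map_map, List.map_map] at h
  rw [clBasis, Module.Basis.map_apply, LinearEquiv.symm_apply_eq]
  refine Eq.trans ?_ h.symm
  refine (ExteriorAlgebra.basis_apply_ofCard _ (rfl : K.card = K.card)).trans ?_
  refine (ExteriorAlgebra.ιMulti_apply _).trans ?_
  congr 1
  refine List.ext_getElem (by simp) fun i h1 h2 => ?_
  rw [List.getElem_ofFn, List.getElem_map, Function.comp_apply, Function.comp_apply,
    Pi.basisFun_apply]
  rfl

/-- The identification `ℝ_m = ℝ^(2^m)` given by the coordinates in the basis `(e_K)`. -/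
def clCoord (m : ℕ) : Cl m ≃ₗ[ℝ] EuclideanSpace ℝ (Finset (Fin m)) :=
  (clBasis m).equivFun.trans (WithLp.linearEquiv 2 ℝ (Finset (Fin m) → ℝ)).symm

/-- The Euclidean norm of `ℝ_m = ℝ^(2^m)`. -/
instance instNormedAddCommGroupCl (m : ℕ) : NormedAddCommGroup (Cl m) :=
  NormedAddCommGroup.induced (Cl m) (EuclideanSpace ℝ (Finset (Fin m))) (clCoord m)
    (clCoord m).injective

instance instNormedSpaceCl (m : ℕ) : NormedSpace ℝ (Cl m) :=
  NormedSpace.induced ℝ (Cl m) (EuclideanSpace ℝ (Finset (Fin m))) (clCoord m)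

instance instFiniteCl (m : ℕ) : Module.Finite ℝ (Cl m) := Module.Finite.of_basis (clBasis m)

/-! ### Paravectors and circular sets -/

/-- The space `ℝ^(m+1)` of paravectors `x = x₀ + x₁ e₁ + ⋯ + x_m e_m`. -/
abbrev Para (m : ℕ) : Type := EuclideanSpace ℝ (Fin (m + 1))

/-- The inclusion of `ℝ^(m+1)` in `ℝ_m`, that is, `x ↦ x₀ + x₁ e₁ + ⋯ + x_m e_m`. -/
def toCl {m : ℕ} (x : Para m) : Cl m :=
  algebraMap ℝ (Cl m) (x 0) + CliffordAlgebra.ι (negForm m) (fun h : Fin m => x h.succ)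

/-- The standard basis vector of `ℝ^(m+1)` with index `k`; the one with index `0` is the unity. -/
def unitVec {m : ℕ} (k : Fin (m + 1)) : Para m := EuclideanSpace.single k (1 : ℝ)

/-- `Im(x) = x - Re(x)`. -/
def imPart {m : ℕ} (x : Para m) : Para m := x - x 0 • unitVec 0

/-- The conjugate `Re(x) - Im(x)`. -/
def conjPara {m : ℕ} (x : Para m) : Para m := x 0 • unitVec 0 - imPart x

/-- The real line inside `ℝ^(m+1)`. -/
def realLine (m : ℕ) : Set (Para m) := {x | imPart x = 0}

/-- The sphere of paravector imaginary units: `I ∈ ℝ^(m+1)` with `I ^ 2 = -1` in `ℝ_m`. -/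
def imUnits (m : ℕ) : Set (Para m) := {x | toCl x ^ 2 = -1}

/-- The map `φ_I : α + iβ ↦ α + Iβ`. -/
def phi {m : ℕ} (I : Para m) (z : ℂ) : Para m := z.re • unitVec 0 + z.im • I

/-- The inverse of `φ_I` on the plane `ℂ_I`, for an imaginary unit `I`; see `phiInv_phi`. -/
def phiInv {m : ℕ} (I x : Para m) : ℂ := ⟨x 0, inner ℝ I x⟩

/-- The complex slice `ℂ_I`. -/
def slicePlane {m : ℕ} (I : Para m) : Set (Para m) := Set.range (phi I)

/-- The circularization of a subset `E` of `ℂ` in `ℝ^(m+1)`. -/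
def circularization (m : ℕ) (E : Set ℂ) : Set (Para m) :=
  {x | ∃ z ∈ E, ∃ I ∈ imUnits m, x = phi I z}

/-- Circular (axially symmetric) subsets of `ℝ^(m+1)`. -/
def IsCircular {m : ℕ} (S : Set (Para m)) : Prop := ∃ E : Set ℂ, S = circularization m E

/-- The set `D` of all `α + iβ` such that `α + Iβ ∈ Ω` for some imaginary unit `I`. If `Ω` is
circular, it is the conjugation invariant subset of `ℂ` whose circularization is `Ω`; see
`circularization_profile` and `conj_mem_profile`. -/
def profile {m : ℕ} (Ω : Set (Para m)) : Set ℂ := {z | ∃ I ∈ imUnits m, phi I z ∈ Ω}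

/-! ### Differential operators

Functions on a subset are represented by total functions; each operator below is local, and is
used only on open sets. -/

/-- The operator `(1/2) (∂/∂α + J ∂/∂β)` on functions from (an open subset of) `ℂ` to `ℝ_m`. -/
def crOp {m : ℕ} (J : Cl m) (g : ℂ → Cl m) : ℂ → Cl m := fun z =>
  (1 / 2 : ℝ) • (fderiv ℝ g z 1 + J * fderiv ℝ g z Complex.I)

/-- The function `∂̄_I^n f_I` on `Ω_I = Ω ∩ ℂ_I`. -/
def debar {m : ℕ} (I : Para m) (n : ℕ) (f : Para m → Cl m) (x : Para m) : Cl m :=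
  (crOp (toCl I))^[n] (f ∘ phi I) (phiInv I x)

/-- The operator `ϑ̄_m = (1/2) (∂/∂x₀ + (Im(x)/|Im(x)|²) ∑_{h=1}^m x_h ∂/∂x_h)`, on functions
on open sets of non-real paravectors. -/
def thetaBar {m : ℕ} (g : Para m → Cl m) : Para m → Cl m := fun x =>
  (1 / 2 : ℝ) • (fderiv ℝ g x (unitVec 0) +
    ((‖imPart x‖ ^ 2)⁻¹ • toCl (imPart x)) *
      ∑ h : Fin m, x h.succ • fderiv ℝ g x (unitVec h.succ))

/-! ### Stem functions and slice functions -/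

/-- Multiplication by `i` on `ℝ_m ⊗ ℂ`, whose elements `a + i b` are written as pairs `(a, b)`. -/
def mulI {m : ℕ} (p : Cl m × Cl m) : Cl m × Cl m := (-p.2, p.1)

/-- `F = F₁ + i F₂ : D → ℝ_m ⊗ ℂ` is a stem function. -/
def IsStem {m : ℕ} (D : Set ℂ) (F : ℂ → Cl m × Cl m) : Prop :=
  ∀ z ∈ D, (F (starRingEnd ℂ z)).1 = (F z).1 ∧ (F (starRingEnd ℂ z)).2 = -(F z).2

/-- `∂F/∂z̄ = (1/2) (∂F/∂α + i ∂F/∂β)` for `F : D → ℝ_m ⊗ ℂ`. -/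
def stemDebar {m : ℕ} (F : ℂ → Cl m × Cl m) : ℂ → Cl m × Cl m := fun z =>
  (1 / 2 : ℝ) • (fderiv ℝ F z 1 + mulI (fderiv ℝ F z Complex.I))

/-- `f = 𝓘(F)` on the circularization of `D`:
`f(α + Iβ) = F₁(α + iβ) + I F₂(α + iβ)` for all `α + iβ ∈ D` and all imaginary units `I`. -/
def IsInducedBy {m : ℕ} (D : Set ℂ) (f : Para m → Cl m) (F : ℂ → Cl m × Cl m) : Prop :=
  ∀ z ∈ D, ∀ I ∈ imUnits m, f (phi I z) = (F z).1 + toCl I * (F z).2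

/-- `f ∈ 𝓢^n(Ω, ℝ_m)`: `f` is a slice function on `Ω` induced by a stem function of class
`C^n`. -/
def IsSliceOfClass {m : ℕ} (n : ℕ) (Ω : Set (Para m)) (f : Para m → Cl m) : Prop :=
  ∃ F : ℂ → Cl m × Cl m, IsStem (profile Ω) F ∧ ContDiffOn ℝ n F (profile Ω) ∧
    IsInducedBy (profile Ω) f F

/-- `g = (∂/∂x^c)^n f` on `Ω`, i.e. `f = 𝓘(F)` with `F` a stem function of class `C^n`, and
`g = 𝓘(∂^n F/∂z̄^n)`. By `isInducedBy_unique`, `F` is unique on `D`, hence so is `g` on `Ω`. -/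
def IsSliceDerivPow {m : ℕ} (n : ℕ) (Ω : Set (Para m)) (f g : Para m → Cl m) : Prop :=
  ∃ F : ℂ → Cl m × Cl m, IsStem (profile Ω) F ∧ ContDiffOn ℝ n F (profile Ω) ∧
    IsInducedBy (profile Ω) f F ∧ IsInducedBy (profile Ω) g (stemDebar^[n] F)

/-! ### Slice monogenic and global slice polymonogenic functions -/

/-- `f` is slice monogenic on `Ω`. -/
def IsSliceMonogenic {m : ℕ} (Ω : Set (Para m)) (f : Para m → Cl m) : Prop :=
  ContDiffOn ℝ 1 f Ω ∧ ∀ I ∈ imUnits m, ∀ x ∈ Ω ∩ slicePlane I, debar I 1 f x = 0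

/-- `f` is global slice polymonogenic of order `n` on `Ω`: `f = ∑_{h<n} x̄^h f_h` with slice
monogenic `f_h`. -/
def IsGlobalSlicePolymonogenic {m : ℕ} (n : ℕ) (Ω : Set (Para m)) (f : Para m → Cl m) : Prop :=
  ∃ fh : Fin n → Para m → Cl m, (∀ h, IsSliceMonogenic Ω (fh h)) ∧
    ∀ x ∈ Ω, f x = ∑ h : Fin n, toCl (conjPara x) ^ (h : ℕ) * fh h x

/-! ### Consistency facts -/

theorem toCl_sq {m : ℕ} (x : Para m) :
    toCl x ^ 2 = algebraMap ℝ (Cl m) (x 0 ^ 2 - ∑ h : Fin m, x h.succ ^ 2) +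
      CliffordAlgebra.ι (negForm m) ((2 * x 0) • fun h : Fin m => x h.succ) := by
  have h1 := CliffordAlgebra.ι_sq_scalar (negForm m) (fun h : Fin m => x h.succ)
  have h2 : negForm m (fun h : Fin m => x h.succ) = -∑ h : Fin m, x h.succ ^ 2 := by
    simp [negForm, pow_two]
  rw [h2] at h1
  have h3 := Algebra.commutes (x 0) (CliffordAlgebra.ι (negForm m) (fun h : Fin m => x h.succ))
  rw [toCl, pow_two, mul_add, add_mul, add_mul, h1, ← h3, sub_eq_add_neg, map_add, map_smul,
    Algebra.smul_def, map_mul, map_pow, map_ofNat]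
  noncomm_ring

/-- The second description of the sphere of imaginary units: `Re(x) = 0` and `|Im(x)| = 1`. -/
theorem mem_imUnits_iff {m : ℕ} (x : Para m) :
    x ∈ imUnits m ↔ x 0 = 0 ∧ ∑ h : Fin m, x h.succ ^ 2 = 1 := by
  have hs := toCl_sq x
  constructor
  · intro hx
    have hx' : toCl x ^ 2 = -1 := hx
    rw [hx'] at hs
    have h1 := congrArg (CliffordAlgebra.equivExterior (negForm m)) hs
    have h4 : (-1 : Cl m) = algebraMap ℝ (Cl m) (-1) := by simp
    rw [h4, map_add] at h1
    simp only [CliffordAlgebra.equivExterior, CliffordAlgebra.changeFormEquiv_apply,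
      CliffordAlgebra.changeForm_algebraMap, CliffordAlgebra.changeForm_ι] at h1
    rw [← sub_eq_iff_eq_add', ← map_sub] at h1
    have h2 := (ExteriorAlgebra.ι_eq_algebraMap_iff (R := ℝ) _ _).1 h1.symm
    obtain ⟨h5, h6⟩ := h2
    have h7 : x 0 = 0 := by
      rcases smul_eq_zero.1 h5 with h | h
      · linarith
      · have h8 : ∑ h : Fin m, x h.succ ^ 2 = 0 :=
          Finset.sum_eq_zero fun k _ => by
            have := congrFun h k
            simp only [Pi.zero_apply] at this
            simp [this]
        rw [h8] at h6
        nlinarith [sq_nonneg (x 0)]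
    refine ⟨h7, ?_⟩
    rw [h7] at h6
    linarith
  · rintro ⟨h0, h1⟩
    change toCl x ^ 2 = -1
    rw [hs, h0, h1]
    simp

theorem neg_mem_imUnits {m : ℕ} {I : Para m} (hI : I ∈ imUnits m) : -I ∈ imUnits m := by
  rw [mem_imUnits_iff] at hI ⊢
  simpa using hI

theorem phi_conj {m : ℕ} (I : Para m) (z : ℂ) : phi (-I) (starRingEnd ℂ z) = phi I z := by
  simp [phi]

theorem phiInv_phi {m : ℕ} {I : Para m} (hI : I ∈ imUnits m) (z : ℂ) :
    phiInv I (phi I z) = z := by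
  obtain ⟨h0, h1⟩ := (mem_imUnits_iff I).1 hI
  apply Complex.ext
  · simp [phiInv, phi, unitVec, h0]
  · have h2 : inner ℝ I I = (1 : ℝ) := by
      rw [PiLp.inner_apply, Fin.sum_univ_succ, h0]
      simpa [pow_two] using h1
    have h3 : inner ℝ I (unitVec 0) = (0 : ℝ) := by
      rw [unitVec, EuclideanSpace.inner_single_right, h0]
      simp
    simp only [phiInv, phi, inner_add_right, inner_smul_right, h2, h3]
    simp

theorem conj_mem_profile {m : ℕ} {Ω : Set (Para m)} {z : ℂ} (hz : z ∈ profile Ω) :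
    starRingEnd ℂ z ∈ profile Ω := by
  obtain ⟨I, hI, h⟩ := hz
  exact ⟨-I, neg_mem_imUnits hI, by rwa [phi_conj]⟩

theorem circularization_profile {m : ℕ} {Ω : Set (Para m)} (hΩ : IsCircular Ω) :
    circularization m (profile Ω) = Ω := by
  obtain ⟨E, rfl⟩ := hΩ
  ext x
  constructor
  · rintro ⟨z, ⟨J, hJ, w, hw, K, hK, h⟩, I, hI, rfl⟩
    obtain ⟨hJ0, hJ1⟩ := (mem_imUnits_iff J).1 hJ
    obtain ⟨hK0, hK1⟩ := (mem_imUnits_iff K).1 hK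
    have hre : z.re = w.re := by
      have := congrArg (fun v : Para m => v 0) h
      simpa [phi, unitVec, hJ0, hK0] using this
    have him : z.im ^ 2 = w.im ^ 2 := by
      have hk : ∀ k : Fin m, z.im * J k.succ = w.im * K k.succ := fun k => by
        have := congrArg (fun v : Para m => v k.succ) h
        simpa [phi, unitVec] using this
      calc z.im ^ 2 = ∑ k : Fin m, (z.im * J k.succ) ^ 2 := by
            simp_rw [mul_pow]; rw [← Finset.mul_sum, hJ1, mul_one]
        _ = ∑ k : Fin m, (w.im * K k.succ) ^ 2 := by simp_rw [hk]
        _ = w.im ^ 2 := by simp_rw [mul_pow]; rw [← Finset.mul_sum, hK1, mul_one]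
    rcases sq_eq_sq_iff_eq_or_eq_neg.1 him with h2 | h2
    · exact ⟨w, hw, I, hI, by simp [phi, hre, h2]⟩
    · exact ⟨w, hw, -I, neg_mem_imUnits hI, by simp [phi, hre, h2]⟩
  · rintro ⟨z, hz, I, hI, rfl⟩
    exact ⟨z, ⟨I, hI, z, hz, I, hI, rfl⟩, I, hI, rfl⟩

theorem toCl_neg {m : ℕ} (x : Para m) : toCl (-x) = -toCl x := by
  have h : (fun h : Fin m => (-x) h.succ) = -(fun h : Fin m => x h.succ) := rfl
  simp only [toCl]
  rw [h, map_neg, PiLp.neg_apply, map_neg]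
  abel

/-- The stem function of a slice function is unique. -/
theorem isInducedBy_unique {m : ℕ} {Ω : Set (Para m)} {f : Para m → Cl m}
    {F G : ℂ → Cl m × Cl m} (hF : IsInducedBy (profile Ω) f F)
    (hG : IsInducedBy (profile Ω) f G) : ∀ z ∈ profile Ω, F z = G z := by
  intro z hz
  obtain ⟨I, hI, -⟩ := id hz
  have h1 := (hF z hz I hI).symm.trans (hG z hz I hI)
  have h2 := (hF z hz _ (neg_mem_imUnits hI)).symm.trans (hG z hz _ (neg_mem_imUnits hI))
  rw [toCl_neg] at h2
  have hI2 : toCl I * toCl I = -1 := by rw [← pow_two]; exact hI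
  have h3 : (2 : ℝ) • (F z).1 = (2 : ℝ) • (G z).1 := by
    rw [two_smul, two_smul]
    have := congrArg₂ (· + ·) h1 h2
    simp only [neg_mul] at this
    calc _ = (F z).1 + toCl I * (F z).2 + ((F z).1 + -(toCl I * (F z).2)) := by abel
      _ = _ := this
      _ = _ := by abel
  have h4 : (F z).1 = (G z).1 := smul_right_injective _ (two_ne_zero) h3
  rw [h4] at h1
  have h5 := congrArg (toCl I * ·) (add_left_cancel h1)
  simp only [← mul_assoc, hI2, neg_mul, one_mul, neg_inj] at h5
  exact Prod.ext h4 h5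

end

end SliceClifford

open SliceClifford

/-!
The stem function of a slice function takes its values in `ℝ_m ⊗ ℂ`, a complex vector space. In the
complex coordinates `stemCoord`, the operator `∂/∂z̄` on stem functions is the Cauchy–Riemann
operator `wirtBar` on functions from an open subset `D` of `ℂ` to a complex normed space. For an
imaginary unit `I`, the evaluation `a + i b ↦ a + I b` carries multiplication by `i` to left
multiplication by `I`. Hence it carries `∂/∂z̄` to `∂̄_I` on the slice `ℂ_I` (`debar_phi`). At a
non-real point `α + I β`, the operator `ϑ̄_m` differentiates along `ℂ_I` only and equals `∂̄_I`
(`thetaBar_phi`), so on slice functions it corresponds to `∂/∂z̄` too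
(`isSliceOn_thetaBar_iterate`). Thus the three differential equations all say that the stem is
annihilated by the `n`-th power of `∂/∂z̄`: on all of `D` for `∂̄_I` and `∂/∂x^c`, off the real line
for `ϑ̄_m`.

The equivalence with global slice polymonogenicity is the structure theorem for polyanalytic
functions, `exists_conj_polynomial`: such a stem is a polynomial in `z̄` of degree less than `n` with
holomorphic coefficients. It is proved by induction on `n`, integrating in `z̄`; the base case is
Painlevé's theorem that the real line is removable for continuous functions holomorphic off it,
`differentiableOn_of_continuousOn_of_off_real`. This is why regularity `C^(n-1)` across the real
line is enough. The holomorphic coefficients are averaged with their reflections to become stem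
functions. The slice functions they induce are slice monogenic; the point to check is that they are
of class `C^1` at the real points, where they are sums of power series in a paravector variable
(`analyticAt_of_isSliceOn`).

Conversely, every slice monogenic function on `Ω` is a slice function with holomorphic stem
(`exists_stem_of_isSliceMonogenic`): this uses the identity theorem on `D`, which is connected
because `Ω` is connected and meets the real line. So a global slice polymonogenic function has a
stem that is a polynomial in `z̄` with holomorphic coefficients, which is smooth and annihilated by
the `n`-th power of `∂/∂z̄` (`wirtBar_iterate_conj_polynomial`).
-/

namespace SliceClifford

noncomputable section

open scoped ComplexConjugate

/-! ### The Cauchy–Riemann operator on vector-valued functions -/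

section Wirtinger

variable {E : Type*} [NormedAddCommGroup E] [NormedSpace ℂ E]

/-- The operator `∂/∂z̄ = (1/2) (∂/∂α + i ∂/∂β)` on functions with values in a complex normed
space. -/
def wirtBar (G : ℂ → E) : ℂ → E := fun z =>
  (1 / 2 : ℝ) • (fderiv ℝ G z 1 + Complex.I • fderiv ℝ G z Complex.I)

theorem wirtBar_congr {U : Set ℂ} (hU : IsOpen U) {A B : ℂ → E} (h : Set.EqOn A B U) :
    Set.EqOn (wirtBar A) (wirtBar B) U := fun z hz => by
  have : A =ᶠ[nhds z] B := h.eventuallyEq_of_mem (hU.mem_nhds hz)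
  simp only [wirtBar, this.fderiv_eq]

theorem wirtBar_iterate_congr {U : Set ℂ} (hU : IsOpen U) {A B : ℂ → E} (h : Set.EqOn A B U)
    (n : ℕ) : Set.EqOn (wirtBar^[n] A) (wirtBar^[n] B) U := by
  induction n generalizing A B with
  | zero => exact h
  | succ n ih => exact ih (wirtBar_congr hU h)

theorem wirtBar_eq_zero {G : ℂ → E} {z : ℂ} (h : DifferentiableAt ℂ G z) : wirtBar G z = 0 := by
  rw [wirtBar, (differentiableAt_complex_iff_differentiableAt_real.1 h).2, smul_smul,
    Complex.I_mul_I]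
  simp

theorem differentiableAt_of_wirtBar_eq_zero {G : ℂ → E} {z : ℂ} (h : DifferentiableAt ℝ G z)
    (h0 : wirtBar G z = 0) : DifferentiableAt ℂ G z := by
  refine differentiableAt_complex_iff_differentiableAt_real.2 ⟨h, ?_⟩
  have h1 : fderiv ℝ G z 1 + Complex.I • fderiv ℝ G z Complex.I = 0 :=
    (smul_eq_zero.1 h0).resolve_left (by norm_num)
  rw [eq_neg_of_add_eq_zero_left h1, smul_neg, smul_smul, Complex.I_mul_I]
  simp

theorem wirtBar_sub {A B : ℂ → E} {z : ℂ} (hA : DifferentiableAt ℝ A z)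
    (hB : DifferentiableAt ℝ B z) :
    wirtBar (fun w => A w - B w) z = wirtBar A z - wirtBar B z := by
  simp only [wirtBar, fderiv_fun_sub hA hB, sub_apply]
  module

theorem wirtBar_sum {ι : Type*} (s : Finset ι) {A : ι → ℂ → E} {z : ℂ}
    (hA : ∀ k ∈ s, DifferentiableAt ℝ (A k) z) :
    wirtBar (fun w => ∑ k ∈ s, A k w) z = ∑ k ∈ s, wirtBar (A k) z := by
  simp only [wirtBar, fderiv_fun_sum hA, sum_apply, Finset.smul_sum,
    ← Finset.sum_add_distrib]

theorem hasFDerivAt_conj_pow (k : ℕ) (z : ℂ) :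
    HasFDerivAt (fun w : ℂ => conj w ^ k)
      (((k : ℂ) * conj z ^ (k - 1)) • (Complex.conjCLE : ℂ →L[ℝ] ℂ)) z := by
  have h := (Complex.conjCLE : ℂ →L[ℝ] ℂ).hasFDerivAt (x := z)
  have := h.pow k
  simpa [nsmul_eq_mul] using this

/-- The product rule for `∂/∂z̄` when one factor is a power of `z̄` and the other is holomorphic. -/
theorem wirtBar_conj_pow_smul (k : ℕ) {g : ℂ → E} {z : ℂ} (hg : DifferentiableAt ℂ g z) :
    wirtBar (fun w => conj w ^ k • g w) z = (k : ℂ) • conj z ^ (k - 1) • g z := by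
  obtain ⟨hr, hI⟩ := differentiableAt_complex_iff_differentiableAt_real.1 hg
  have h := ((hasFDerivAt_conj_pow k z).smul hr.hasFDerivAt).fderiv
  simp only [wirtBar]
  change (1 / 2 : ℝ) • ((fderiv ℝ ((fun w : ℂ => conj w ^ k) • g) z) 1 +
    Complex.I • (fderiv ℝ ((fun w : ℂ => conj w ^ k) • g) z) Complex.I) = _
  rw [h]
  simp only [add_apply, smul_apply,
    ContinuousLinearMap.smulRight_apply, ContinuousLinearEquiv.coe_coe, hI]
  simp only [Complex.conjCLE_apply, map_one, Complex.conj_I, smul_eq_mul, mul_one, smul_add,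
    smul_smul, smul_comm (conj z ^ k) Complex.I]
  have e : ∀ c : ℂ, Complex.I * (c * -Complex.I) = c := fun c => by
    linear_combination (-c) * Complex.I_mul_I
  rw [e, ← mul_assoc Complex.I, Complex.I_mul_I]
  module

theorem contDiffOn_wirtBar {U : Set ℂ} (hU : IsOpen U) {G : ℂ → E} {n : ℕ}
    (hG : ContDiffOn ℝ (n + 1 : ℕ) G U) : ContDiffOn ℝ n (wirtBar G) U := by
  have h := hG.fderiv_of_isOpen hU (m := (n : WithTop ℕ∞)) (by norm_cast)
  exact contDiffOn_const.smul ((h.clm_apply contDiffOn_const).add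
    (contDiffOn_const.smul (h.clm_apply contDiffOn_const)))

/-- Every polynomial in `z̄` of degree less than `n` with holomorphic coefficients is annihilated by
the `n`-th power of `∂/∂z̄`. -/
theorem wirtBar_iterate_conj_polynomial {U : Set ℂ} (hU : IsOpen U) (n : ℕ) (g : ℕ → ℂ → E)
    (hg : ∀ k, DifferentiableOn ℂ (g k) U) :
    ∀ z ∈ U, wirtBar^[n] (fun w => ∑ k ∈ Finset.range n, conj w ^ k • g k w) z = 0 := by
  induction n generalizing g with
  | zero => simp
  | succ n ih =>
    intro z hz
    rw [Function.iterate_succ_apply]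
    refine (wirtBar_iterate_congr hU (B := fun w => ∑ k ∈ Finset.range n,
      conj w ^ k • (((k + 1 : ℕ) : ℂ) • g (k + 1) w)) (fun w hw => ?_) n hz).trans
      (ih (fun k w => ((k + 1 : ℕ) : ℂ) • g (k + 1) w) (fun k => (hg _).const_smul _) z hz)
    have hd : ∀ k, DifferentiableAt ℂ (g k) w := fun k => (hg k).differentiableAt (hU.mem_nhds hw)
    have hp : ∀ k ∈ Finset.range (n + 1), DifferentiableAt ℝ (fun w => conj w ^ k • g k w) w :=
      fun k _ => ((hasFDerivAt_conj_pow k w).differentiableAt).smul ((hd k).restrictScalars ℝ)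
    rw [wirtBar_sum _ hp, Finset.sum_range_succ']
    simp only [wirtBar_conj_pow_smul _ (hd _)]
    simp only [Nat.cast_zero, zero_smul, add_zero, Nat.add_sub_cancel]
    exact Finset.sum_congr rfl fun k _ => smul_comm _ _ _

variable [CompleteSpace E]

/-- Painlevé's theorem: the real line is removable for continuous functions that are holomorphic
off it. A rectangle crossing the line is cut along it, and each half is treated by the
Cauchy–Goursat theorem, so that Morera's theorem applies. -/
theorem differentiableOn_of_continuousOn_of_off_real {U : Set ℂ} (hU : IsOpen U) {h : ℂ → E}
    (hc : ContinuousOn h U) (hd : DifferentiableOn ℂ h (U \ {z | z.im = 0})) :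
    DifferentiableOn ℂ h U := by
  refine (Complex.isConservativeOn_and_continuousOn_iff_isDifferentiableOn hU).1 ⟨?_, hc⟩
  have key : ∀ a b c d : ℝ, Set.uIcc a b ×ℂ Set.uIcc c d ⊆ U →
      (0 : ℝ) ∉ Set.Ioo (min c d) (max c d) →
      (∫ x : ℝ in a..b, h (x + c * Complex.I)) - (∫ x : ℝ in a..b, h (x + d * Complex.I)) +
      Complex.I • (∫ y : ℝ in c..d, h (b + y * Complex.I)) -
      Complex.I • (∫ y : ℝ in c..d, h (a + y * Complex.I)) = 0 := by
    intro a b c d hs h0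
    refine Complex.integral_boundary_rect_eq_zero_of_continuousOn_of_differentiableOn h
      ⟨a, c⟩ ⟨b, d⟩ (hc.mono hs) (hd.mono ?_)
    rintro x ⟨hx, hy⟩
    refine ⟨hs ⟨Set.Ioo_subset_Icc_self hx, Set.Ioo_subset_Icc_self hy⟩, fun hx0 => h0 ?_⟩
    have hx0 : x.im = 0 := hx0
    rw [← hx0]
    exact hy
  intro z w hzw
  rw [← add_eq_zero_iff_eq_neg, Complex.wedgeIntegral_add_wedgeIntegral_eq]
  by_cases h0 : (0 : ℝ) ∈ Set.Ioo (min z.im w.im) (max z.im w.im)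
  · have h0' : (0 : ℝ) ∈ Set.uIcc z.im w.im := Set.Ioo_subset_Icc_self h0
    have hs1 : Set.uIcc z.im 0 ⊆ Set.uIcc z.im w.im := Set.uIcc_subset_uIcc_left h0'
    have hs2 : Set.uIcc 0 w.im ⊆ Set.uIcc z.im w.im := Set.uIcc_subset_uIcc_right h0'
    have k1 := key z.re w.re z.im 0 (fun x hx => hzw ⟨hx.1, hs1 hx.2⟩) (by
      rcases le_total z.im 0 with h | h <;> simp [h])
    have k2 := key z.re w.re 0 w.im (fun x hx => hzw ⟨hx.1, hs2 hx.2⟩) (by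
      rcases le_total w.im 0 with h | h <;> simp [h])
    have hi : ∀ a ∈ Set.uIcc z.re w.re, ContinuousOn (fun y : ℝ => h (a + y * Complex.I))
        (Set.uIcc z.im w.im) := fun a ha =>
      hc.comp (by fun_prop) fun y hy => hzw ⟨by simpa using ha, by simpa using hy⟩
    have hadd : ∀ a ∈ Set.uIcc z.re w.re, ∫ y : ℝ in z.im..w.im, h (a + y * Complex.I) =
        (∫ y : ℝ in z.im..0, h (a + y * Complex.I)) + ∫ y : ℝ in (0 : ℝ)..w.im,
          h (a + y * Complex.I) := fun a ha =>
      (intervalIntegral.integral_add_adjacent_intervals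
        ((hi a ha).mono hs1).intervalIntegrable ((hi a ha).mono hs2).intervalIntegrable).symm
    rw [hadd _ Set.left_mem_uIcc, hadd _ Set.right_mem_uIcc, smul_add, smul_add]
    have := congrArg₂ (· + ·) k1 k2
    simp only [add_zero] at this
    rw [← this]
    abel
  · exact key _ _ _ _ hzw h0

/-- The structure of polyanalytic functions, with the real line as a removable singularity: a
function of class `C^(n-1)` that is of class `C^n` and annihilated by the `n`-th power of `∂/∂z̄`
off the real line is a polynomial in `z̄` of degree less than `n` with holomorphic coefficients. -/
theorem exists_conj_polynomial {U : Set ℂ} (hU : IsOpen U) (n : ℕ) {G : ℂ → E}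
    (hG : ContDiffOn ℝ n G U) (hG' : ContDiffOn ℝ (n + 1 : ℕ) G (U \ {z | z.im = 0}))
    (h0 : ∀ z ∈ U \ {z | z.im = 0}, wirtBar^[n + 1] G z = 0) :
    ∃ g : ℕ → ℂ → E, (∀ k, DifferentiableOn ℂ (g k) U) ∧
      ∀ z ∈ U, G z = ∑ k ∈ Finset.range (n + 1), conj z ^ k • g k z := by
  have hU' : IsOpen (U \ {z : ℂ | z.im = 0}) :=
    hU.sdiff (isClosed_eq Complex.continuous_im continuous_const)
  induction n generalizing G with
  | zero =>
    refine ⟨fun _ => G, fun _ => ?_, fun z _ => by simp⟩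
    refine differentiableOn_of_continuousOn_of_off_real hU hG.continuousOn fun z hz => ?_
    exact (differentiableAt_of_wirtBar_eq_zero ((hG'.differentiableOn (by simp)).differentiableAt
      (hU'.mem_nhds hz)) (h0 z hz)).differentiableWithinAt
  | succ n ih =>
    obtain ⟨h, hh, hs⟩ := ih (contDiffOn_wirtBar hU hG) (contDiffOn_wirtBar hU' hG') h0
    -- a primitive of `∂G/∂z̄` with respect to `z̄`
    let K : ℂ → E := fun w =>
      ∑ k ∈ Finset.range (n + 1), conj w ^ (k + 1) • (((k : ℂ) + 1)⁻¹ • h k w)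
    have hd : ∀ z ∈ U, ∀ k : ℕ, DifferentiableAt ℂ (fun w => ((k : ℂ) + 1)⁻¹ • h k w) z :=
      fun z hz k => ((hh k).differentiableAt (hU.mem_nhds hz)).const_smul _
    have hKd : ∀ z ∈ U, ∀ k ∈ Finset.range (n + 1), DifferentiableAt ℝ
        (fun w => conj w ^ (k + 1) • (((k : ℂ) + 1)⁻¹ • h k w)) z := fun z hz k _ =>
      ((hasFDerivAt_conj_pow (k + 1) z).differentiableAt).smul ((hd z hz k).restrictScalars ℝ)
    have hGK : DifferentiableOn ℂ (fun w => G w - K w) U := fun z hz => by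
      have h1 : DifferentiableAt ℝ G z :=
        (hG.differentiableOn (by simp)).differentiableAt (hU.mem_nhds hz)
      have h2 : DifferentiableAt ℝ K z := DifferentiableAt.fun_sum (hKd z hz)
      refine (differentiableAt_of_wirtBar_eq_zero (h1.sub h2) ?_).differentiableWithinAt
      refine (wirtBar_sub h1 h2).trans ?_
      rw [wirtBar_sum _ (hKd z hz), hs z hz, ← Finset.sum_sub_distrib]
      refine Finset.sum_eq_zero fun k _ => ?_
      have hk : (k + 1 : ℂ) ≠ 0 := Nat.cast_add_one_ne_zero k
      rw [wirtBar_conj_pow_smul _ (hd z hz k), Nat.add_sub_cancel, sub_eq_zero,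
        smul_comm (conj z ^ k), Nat.cast_add_one, smul_inv_smul₀ hk]
    refine ⟨fun k => Nat.casesOn k (fun w => G w - K w) fun k w => ((k : ℂ) + 1)⁻¹ • h k w, ?_, ?_⟩
    · rintro (_ | k)
      · exact hGK
      · exact (hh k).const_smul _
    · intro z _
      rw [Finset.sum_range_succ']
      simp [K]

end Wirtinger

/-! ### Complex coordinates on the complexified Clifford algebra -/

/-- Left multiplication on `ℝ_m`, as a continuous bilinear map. -/
def leftMul (m : ℕ) : Cl m →L[ℝ] Cl m →L[ℝ] Cl m :=
  ((LinearMap.toContinuousLinearMap : (Cl m →ₗ[ℝ] Cl m) ≃ₗ[ℝ] (Cl m →L[ℝ] Cl m)).toLinearMap ∘ₗ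
    LinearMap.mul ℝ (Cl m)).toContinuousLinearMap

@[simp] theorem leftMul_apply {m : ℕ} (a b : Cl m) : leftMul m a b = a * b := rfl

theorem leftMul_iterate {m : ℕ} (a b : Cl m) (k : ℕ) : (leftMul m a)^[k] b = a ^ k * b := by
  induction k generalizing b with
  | zero => simp
  | succ k ih => rw [Function.iterate_succ_apply, ih, leftMul_apply, pow_succ, mul_assoc]

/-- The inclusion of the paravectors in `ℝ_m` as a continuous linear map. -/
def toClL (m : ℕ) : Para m →L[ℝ] Cl m :=
  LinearMap.toContinuousLinearMap
    { toFun := toCl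
      map_add' := fun x y => by
        have h : (fun h : Fin m => (x + y) h.succ) =
          (fun h : Fin m => x h.succ) + (fun h : Fin m => y h.succ) := rfl
        simp only [toCl]
        rw [h, map_add, PiLp.add_apply, map_add]
        abel
      map_smul' := fun c x => by
        have h : (fun h : Fin m => (c • x) h.succ) = c • (fun h : Fin m => x h.succ) := rfl
        simp only [toCl]
        rw [h, map_smul, PiLp.smul_apply, smul_eq_mul, map_mul, ← Algebra.smul_def,
          RingHom.id_apply, smul_add] }

@[simp] theorem toClL_apply {m : ℕ} (x : Para m) : toClL m x = toCl x := rfl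

theorem toCl_add {m : ℕ} (x y : Para m) : toCl (x + y) = toCl x + toCl y := map_add (toClL m) x y

theorem toCl_smul {m : ℕ} (c : ℝ) (x : Para m) : toCl (c • x) = c • toCl x :=
  map_smul (toClL m) c x

theorem toCl_unitVec_zero {m : ℕ} : toCl (unitVec 0 : Para m) = 1 := by
  have h : (fun h : Fin m => (unitVec 0 : Para m) h.succ) = 0 := by
    funext h
    simp [unitVec]
  rw [toCl, h]
  simp [unitVec]

theorem toCl_phi {m : ℕ} (I : Para m) (z : ℂ) :
    toCl (phi I z) = algebraMap ℝ (Cl m) z.re + z.im • toCl I := by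
  rw [phi, toCl_add, toCl_smul, toCl_smul, toCl_unitVec_zero, Algebra.algebraMap_eq_smul_one]

/-- The complex linear coordinates of `ℝ_m ⊗ ℂ` in the basis `(e_K)`. They turn the stem functions
into functions with values in a complex normed space, to which complex analysis applies. -/
def stemCoord (m : ℕ) : (Cl m × Cl m) ≃L[ℝ] (Finset (Fin m) → ℂ) :=
  LinearEquiv.toContinuousLinearEquiv
    { toFun := fun p K => ⟨(clBasis m).equivFun p.1 K, (clBasis m).equivFun p.2 K⟩
      invFun := fun v => ((clBasis m).equivFun.symm fun K => (v K).re,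
        (clBasis m).equivFun.symm fun K => (v K).im)
      map_add' := fun p q => by
        funext K
        apply Complex.ext <;> simp
      map_smul' := fun c p => by
        funext K
        apply Complex.ext <;> simp
      left_inv := fun p => by simp
      right_inv := fun v => by simp only [LinearEquiv.apply_symm_apply, Complex.eta] }

theorem stemCoord_apply {m : ℕ} (p : Cl m × Cl m) (K : Finset (Fin m)) :
    stemCoord m p K = ⟨(clBasis m).equivFun p.1 K, (clBasis m).equivFun p.2 K⟩ := rfl

theorem stemCoord_mulI {m : ℕ} (p : Cl m × Cl m) :
    stemCoord m (mulI p) = Complex.I • stemCoord m p := by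
  funext K
  rw [Pi.smul_apply, stemCoord_apply, stemCoord_apply]
  apply Complex.ext <;> simp [mulI]

theorem stemCoord_conj {m : ℕ} (a b : Cl m) :
    stemCoord m (a, -b) = star (stemCoord m (a, b)) := by
  funext K
  rw [Pi.star_apply, stemCoord_apply, stemCoord_apply]
  apply Complex.ext <;> simp

theorem stemCoord_symm_I_smul {m : ℕ} (v : Finset (Fin m) → ℂ) :
    (stemCoord m).symm (Complex.I • v) = mulI ((stemCoord m).symm v) := by
  rw [ContinuousLinearEquiv.symm_apply_eq, stemCoord_mulI, ContinuousLinearEquiv.apply_symm_apply]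

theorem stemCoord_symm_star {m : ℕ} (v : Finset (Fin m) → ℂ) :
    (stemCoord m).symm (star v) = (((stemCoord m).symm v).1, -((stemCoord m).symm v).2) := by
  rw [ContinuousLinearEquiv.symm_apply_eq, stemCoord_conj, Prod.mk.eta,
    ContinuousLinearEquiv.apply_symm_apply]

theorem stemCoord_stemDebar {m : ℕ} (F : ℂ → Cl m × Cl m) :
    stemCoord m ∘ stemDebar F = wirtBar (stemCoord m ∘ F) := by
  funext z
  simp only [Function.comp_apply, stemDebar, wirtBar, ContinuousLinearEquiv.comp_fderiv, map_smul,
    map_add, stemCoord_mulI]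
  rfl

theorem stemCoord_stemDebar_iterate {m : ℕ} (n : ℕ) (F : ℂ → Cl m × Cl m) :
    stemCoord m ∘ stemDebar^[n] F = wirtBar^[n] (stemCoord m ∘ F) := by
  induction n generalizing F with
  | zero => rfl
  | succ n ih => rw [Function.iterate_succ_apply, ih, stemCoord_stemDebar,
      Function.iterate_succ_apply]

theorem isStem_iff {m : ℕ} {D : Set ℂ} {F : ℂ → Cl m × Cl m} :
    IsStem D F ↔ ∀ z ∈ D, stemCoord m (F (conj z)) = star (stemCoord m (F z)) := by
  refine forall₂_congr fun z _ => ?_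
  rw [← Prod.mk.eta (p := F z), ← stemCoord_conj, (stemCoord m).injective.eq_iff, Prod.ext_iff]

/-! ### Evaluation of stems on slices -/

/-- The map `ℝ_m ⊗ ℂ → ℝ_m`, `a + i b ↦ a + J b`, in complex coordinates. -/
def sliceEval {m : ℕ} (J : Cl m) : (Finset (Fin m) → ℂ) →L[ℝ] Cl m :=
  (ContinuousLinearMap.fst ℝ (Cl m) (Cl m) + leftMul m J ∘L ContinuousLinearMap.snd ℝ (Cl m) (Cl m))
    ∘L ((stemCoord m).symm : (Finset (Fin m) → ℂ) →L[ℝ] Cl m × Cl m)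

theorem sliceEval_apply {m : ℕ} (J : Cl m) (v : Finset (Fin m) → ℂ) :
    sliceEval J v = ((stemCoord m).symm v).1 + J * ((stemCoord m).symm v).2 := rfl

theorem sliceEval_stemCoord {m : ℕ} (J : Cl m) (p : Cl m × Cl m) :
    sliceEval J (stemCoord m p) = p.1 + J * p.2 := by
  rw [sliceEval_apply, ContinuousLinearEquiv.symm_apply_apply]

theorem sliceEval_neg_star {m : ℕ} (J : Cl m) (v : Finset (Fin m) → ℂ) :
    sliceEval (-J) (star v) = sliceEval J v := by
  simp [sliceEval_apply, stemCoord_symm_star]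

theorem stemCoord_symm_snd_eq_zero {m : ℕ} {v : Finset (Fin m) → ℂ} (hv : star v = v) :
    ((stemCoord m).symm v).2 = 0 := by
  have h := congrArg Prod.snd (stemCoord_symm_star v)
  rw [hv] at h
  refine (smul_eq_zero.1 ?_).resolve_left (two_ne_zero (α := ℝ))
  rw [two_smul]
  nth_rewrite 1 [h]
  exact neg_add_cancel _

/-- A stem that is invariant under conjugation has the same value on all slices. -/
theorem sliceEval_eq_of_star_eq {m : ℕ} {v : Finset (Fin m) → ℂ} (hv : star v = v) (J K : Cl m) :
    sliceEval J v = sliceEval K v := by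
  simp [sliceEval_apply, stemCoord_symm_snd_eq_zero hv]

theorem sliceEval_I_smul {m : ℕ} {J : Cl m} (hJ : J * J = -1) (v : Finset (Fin m) → ℂ) :
    sliceEval J (Complex.I • v) = J * sliceEval J v := by
  rw [sliceEval_apply, sliceEval_apply, stemCoord_symm_I_smul, mul_add, ← mul_assoc, hJ]
  simp [mulI, add_comm]

theorem sliceEval_smul {m : ℕ} {J : Cl m} (hJ : J * J = -1) (c : ℂ) (v : Finset (Fin m) → ℂ) :
    sliceEval J (c • v) = (algebraMap ℝ (Cl m) c.re + c.im • J) * sliceEval J v := by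
  have h : c • v = c.re • v + c.im • Complex.I • v := by
    funext K
    simp only [Pi.smul_apply, Pi.add_apply, Complex.real_smul, smul_eq_mul]
    conv_lhs => rw [← Complex.re_add_im c]
    ring
  rw [h, map_add, map_smul, map_smul, sliceEval_I_smul hJ, add_mul, smul_mul_assoc,
    ← Algebra.smul_def]

theorem toCl_mul_self {m : ℕ} {I : Para m} (hI : I ∈ imUnits m) : toCl I * toCl I = -1 := by
  rw [← pow_two]
  exact hI

theorem sliceEval_pow_smul {m : ℕ} {I : Para m} (hI : I ∈ imUnits m) (c : ℂ) (k : ℕ)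
    (v : Finset (Fin m) → ℂ) :
    sliceEval (toCl I) (c ^ k • v) = toCl (phi I c) ^ k * sliceEval (toCl I) v := by
  induction k generalizing v with
  | zero => simp
  | succ k ih => rw [pow_succ, mul_smul, ih, sliceEval_smul (toCl_mul_self hI), ← toCl_phi,
      pow_succ, mul_assoc]

theorem eq_zero_of_sliceEval_eq_zero {m : ℕ} {J : Cl m} (hJ : J * J = -1)
    {v : Finset (Fin m) → ℂ} (h1 : sliceEval J v = 0) (h2 : sliceEval (-J) v = 0) : v = 0 := by
  rw [sliceEval_apply] at h1 h2
  have h3 : (2 : ℝ) • ((stemCoord m).symm v).1 = 0 := by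
    rw [two_smul, ← add_zero (0 : Cl m)]
    nth_rewrite 1 [← h1]
    rw [← h2, neg_mul]
    abel
  have h4 := (smul_eq_zero.1 h3).resolve_left two_ne_zero
  rw [h4, zero_add] at h1
  have h5 : ((stemCoord m).symm v).2 = 0 := by
    have := congrArg (J * ·) h1
    simpa [← mul_assoc, hJ] using this
  exact (ContinuousLinearEquiv.map_eq_zero_iff (stemCoord m).symm).1 (Prod.ext h4 h5)

/-- The section `c ↦ (1/2) (c - i J c)` of `sliceEval J`, complex linear for the complex structure
of `ℝ_m` given by left multiplication by `J`. -/
def sliceLift {m : ℕ} (J : Cl m) : Cl m →L[ℝ] (Finset (Fin m) → ℂ) :=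
  (stemCoord m : Cl m × Cl m →L[ℝ] (Finset (Fin m) → ℂ)) ∘L
    ((1 / 2 : ℝ) • (ContinuousLinearMap.id ℝ (Cl m)).prod (-leftMul m J))

theorem sliceLift_apply {m : ℕ} (J c : Cl m) :
    sliceLift J c = stemCoord m ((1 / 2 : ℝ) • (c, -(J * c))) := rfl

theorem sliceLift_mul {m : ℕ} {J : Cl m} (hJ : J * J = -1) (c : Cl m) :
    sliceLift J (J * c) = Complex.I • sliceLift J c := by
  rw [sliceLift_apply, sliceLift_apply, ← stemCoord_mulI, ← mul_assoc, hJ]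
  simp [mulI]

theorem sliceEval_sliceLift {m : ℕ} {J : Cl m} (hJ : J * J = -1) (c : Cl m) :
    sliceEval J (sliceLift J c) = c := by
  rw [sliceLift_apply, sliceEval_stemCoord]
  simp only [Prod.smul_mk, mul_smul_comm, mul_neg, ← mul_assoc, hJ, neg_mul, one_mul, neg_neg]
  module

theorem crOp_congr {m : ℕ} (J : Cl m) {U : Set ℂ} (hU : IsOpen U) {A B : ℂ → Cl m}
    (h : Set.EqOn A B U) : Set.EqOn (crOp J A) (crOp J B) U := fun z hz => by
  have : A =ᶠ[nhds z] B := h.eventuallyEq_of_mem (hU.mem_nhds hz)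
  simp only [crOp, this.fderiv_eq]

theorem crOp_sliceEval {m : ℕ} {J : Cl m} (hJ : J * J = -1) {G : ℂ → Finset (Fin m) → ℂ} {z : ℂ}
    (hG : DifferentiableAt ℝ G z) :
    crOp J (sliceEval J ∘ G) z = sliceEval J (wirtBar G z) := by
  rw [crOp, wirtBar, ((sliceEval J).hasFDerivAt.comp z hG.hasFDerivAt).fderiv, map_smul, map_add,
    sliceEval_I_smul hJ]
  rfl

theorem crOp_iterate_sliceEval {m : ℕ} {J : Cl m} (hJ : J * J = -1) {U : Set ℂ} (hU : IsOpen U)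
    (n : ℕ) {G : ℂ → Finset (Fin m) → ℂ} (hG : ContDiffOn ℝ n G U) {h : ℂ → Cl m}
    (hh : Set.EqOn h (sliceEval J ∘ G) U) :
    Set.EqOn ((crOp J)^[n] h) (sliceEval J ∘ wirtBar^[n] G) U := by
  induction n generalizing h G with
  | zero => exact hh
  | succ n ih =>
    refine ih (contDiffOn_wirtBar hU hG) fun z hz => ?_
    rw [crOp_congr J hU hh hz, crOp_sliceEval hJ
      ((hG.differentiableOn (by simp)).differentiableAt (hU.mem_nhds hz))]
    rfl

theorem wirtBar_sliceLift {m : ℕ} {J : Cl m} (hJ : J * J = -1) {h : ℂ → Cl m} {z : ℂ}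
    (hd : DifferentiableAt ℝ h z) :
    wirtBar (sliceLift J ∘ h) z = sliceLift J (crOp J h z) := by
  rw [crOp, wirtBar, ((sliceLift J).hasFDerivAt.comp z hd.hasFDerivAt).fderiv, map_smul, map_add,
    sliceLift_mul hJ]
  rfl

/-- A function into `ℝ_m` that is holomorphic for left multiplication by `J` lifts to a holomorphic
function into `ℝ_m ⊗ ℂ`. -/
theorem differentiableAt_sliceLift {m : ℕ} {J : Cl m} (hJ : J * J = -1) {h : ℂ → Cl m} {z : ℂ}
    (hd : DifferentiableAt ℝ h z) (h0 : crOp J h z = 0) :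
    DifferentiableAt ℂ (sliceLift J ∘ h) z :=
  differentiableAt_of_wirtBar_eq_zero ((sliceLift J).differentiableAt.comp z hd)
    (by rw [wirtBar_sliceLift hJ hd, h0, map_zero])

/-! ### Geometry of circular sets -/

theorem imPart_zero_apply {m : ℕ} (x : Para m) : imPart x 0 = 0 := by
  simp [imPart, unitVec]

theorem imPart_succ {m : ℕ} (x : Para m) (h : Fin m) : imPart x h.succ = x h.succ := by
  simp [imPart, unitVec]

theorem norm_sq_of_zero_apply {m : ℕ} {x : Para m} (h : x 0 = 0) :
    ‖x‖ ^ 2 = ∑ k : Fin m, x k.succ ^ 2 := by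
  rw [EuclideanSpace.norm_sq_eq, Fin.sum_univ_succ, h]
  simp

theorem mem_imUnits_iff_norm {m : ℕ} {x : Para m} : x ∈ imUnits m ↔ x 0 = 0 ∧ ‖x‖ = 1 := by
  rw [mem_imUnits_iff]
  refine and_congr_right fun h => ?_
  rw [← norm_sq_of_zero_apply h, pow_eq_one_iff_of_nonneg (norm_nonneg x) two_ne_zero]

theorem imUnits_nonempty {m : ℕ} (hm : 0 < m) : (imUnits m).Nonempty :=
  ⟨unitVec (Fin.succ ⟨0, hm⟩), mem_imUnits_iff_norm.2
    ⟨by simp [unitVec], by simp [unitVec]⟩⟩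

/-- The point `Re(x) + i |Im(x)|` of the closed upper half plane. -/
def upperPoint {m : ℕ} (x : Para m) : ℂ := (x 0 : ℂ) + (‖imPart x‖ : ℂ) * Complex.I

/-- The direction `Im(x) / |Im(x)|` of the imaginary part of a non-real paravector; it is `0` if `x`
is real. -/
def imDir {m : ℕ} (x : Para m) : Para m := ‖imPart x‖⁻¹ • imPart x

@[simp] theorem upperPoint_re {m : ℕ} (x : Para m) : (upperPoint x).re = x 0 := by
  simp [upperPoint]

@[simp] theorem upperPoint_im {m : ℕ} (x : Para m) : (upperPoint x).im = ‖imPart x‖ := by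
  simp [upperPoint]

theorem imDir_mem_imUnits {m : ℕ} {x : Para m} (hx : imPart x ≠ 0) : imDir x ∈ imUnits m :=
  mem_imUnits_iff_norm.2 ⟨by simp [imDir, imPart_zero_apply], norm_smul_inv_norm hx⟩

theorem phi_upperPoint_imDir {m : ℕ} {x : Para m} (hx : imPart x ≠ 0) :
    phi (imDir x) (upperPoint x) = x := by
  rw [phi, upperPoint_re, upperPoint_im, imDir, smul_inv_smul₀ (norm_ne_zero_iff.2 hx), imPart]
  abel

theorem phi_apply_zero {m : ℕ} {I : Para m} (hI : I ∈ imUnits m) (z : ℂ) : phi I z 0 = z.re := by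
  simp [phi, unitVec, (mem_imUnits_iff_norm.1 hI).1]

theorem imPart_phi {m : ℕ} {I : Para m} (hI : I ∈ imUnits m) (z : ℂ) :
    imPart (phi I z) = z.im • I := by
  rw [imPart, phi_apply_zero hI, phi]
  abel

theorem norm_imPart_phi {m : ℕ} {I : Para m} (hI : I ∈ imUnits m) (z : ℂ) :
    ‖imPart (phi I z)‖ = |z.im| := by
  rw [imPart_phi hI, norm_smul, (mem_imUnits_iff_norm.1 hI).2, mul_one, Real.norm_eq_abs]

theorem imPart_phi_eq_zero_iff {m : ℕ} {I : Para m} (hI : I ∈ imUnits m) (z : ℂ) :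
    imPart (phi I z) = 0 ↔ z.im = 0 := by
  rw [← norm_eq_zero, norm_imPart_phi hI, abs_eq_zero]

theorem upperPoint_phi_of_nonneg {m : ℕ} {I : Para m} (hI : I ∈ imUnits m) {z : ℂ}
    (hz : 0 ≤ z.im) : upperPoint (phi I z) = z := by
  apply Complex.ext
  · rw [upperPoint_re, phi_apply_zero hI]
  · rw [upperPoint_im, norm_imPart_phi hI, abs_of_nonneg hz]

theorem conjPara_phi {m : ℕ} {I : Para m} (hI : I ∈ imUnits m) (z : ℂ) :
    conjPara (phi I z) = phi I (conj z) := by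
  rw [conjPara, imPart_phi hI, phi_apply_zero hI, phi, Complex.conj_re, Complex.conj_im, neg_smul,
    sub_eq_add_neg]

/-- The map `φ_I` as a continuous linear map. -/
def phiL {m : ℕ} (I : Para m) : ℂ →L[ℝ] Para m :=
  Complex.reCLM.smulRight (unitVec 0) + Complex.imCLM.smulRight I

theorem phiL_apply {m : ℕ} (I : Para m) (z : ℂ) : phiL I z = phi I z := rfl

theorem continuous_phi {m : ℕ} (I : Para m) : Continuous (phi I) := (phiL I).continuous

/-- The map `x ↦ Im(x)` as a continuous linear map. -/
def imPartL (m : ℕ) : Para m →L[ℝ] Para m :=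
  ContinuousLinearMap.id ℝ (Para m) -
    (EuclideanSpace.proj (0 : Fin (m + 1)) : Para m →L[ℝ] ℝ).smulRight (unitVec 0)

theorem continuous_imPart {m : ℕ} : Continuous (imPart : Para m → Para m) :=
  (imPartL m).continuous

theorem continuous_upperPoint {m : ℕ} : Continuous (upperPoint : Para m → ℂ) := by
  have := (continuous_imPart (m := m)).norm
  unfold upperPoint
  fun_prop

section Circular

variable {m : ℕ} {Ω : Set (Para m)}

theorem phi_mem_of_mem_profile (hΩ : IsCircular Ω) {z : ℂ} (hz : z ∈ profile Ω) {I : Para m}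
    (hI : I ∈ imUnits m) : phi I z ∈ Ω := by
  rw [← circularization_profile hΩ]
  exact ⟨z, hz, I, hI, rfl⟩

theorem exists_phi_of_mem (hΩ : IsCircular Ω) {x : Para m} (hx : x ∈ Ω) :
    ∃ z ∈ profile Ω, ∃ I ∈ imUnits m, x = phi I z := by
  rw [← circularization_profile hΩ] at hx
  exact hx

theorem isOpen_profile (hΩ : IsOpen Ω) : IsOpen (profile Ω) := by
  have : profile Ω = ⋃ I ∈ imUnits m, phi I ⁻¹' Ω := by
    ext z
    simp [profile]
  rw [this]
  exact isOpen_biUnion fun I _ => hΩ.preimage (continuous_phi I)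

theorem upperPoint_mem_profile (hΩ : IsCircular Ω) {x : Para m} (hx : x ∈ Ω) :
    upperPoint x ∈ profile Ω := by
  obtain ⟨z, hz, I, hI, rfl⟩ := exists_phi_of_mem hΩ hx
  rcases le_total 0 z.im with h | h
  · rwa [upperPoint_phi_of_nonneg hI h]
  · rw [← phi_conj, upperPoint_phi_of_nonneg (neg_mem_imUnits hI) (by simpa using h)]
    exact conj_mem_profile hz

/-- The upper half of the profile is a continuous image of `Ω`; the profile is connected because
its two halves are glued along the real points. -/
theorem isPreconnected_profile (hΩ : IsCircular Ω) (hconn : IsPreconnected Ω)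
    (hreal : (Ω ∩ realLine m).Nonempty) : IsPreconnected (profile Ω) := by
  obtain ⟨p, hp, hp0⟩ := hreal
  have h1 : IsPreconnected (upperPoint '' Ω) :=
    hconn.image _ continuous_upperPoint.continuousOn
  have h2 : IsPreconnected (conj '' (upperPoint '' Ω)) :=
    h1.image _ Complex.continuous_conj.continuousOn
  have hpc : conj (upperPoint p) = upperPoint p := by
    have hp0 : imPart p = 0 := hp0
    simp [upperPoint, hp0]
  have hmem : upperPoint p ∈ conj '' (upperPoint '' Ω) :=
    ⟨_, Set.mem_image_of_mem _ hp, hpc⟩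
  have h := IsPreconnected.union (upperPoint p) (Set.mem_image_of_mem _ hp) hmem h1 h2
  convert h using 1
  apply Set.Subset.antisymm
  · rintro z ⟨I, hI, hz⟩
    rcases le_total 0 z.im with h | h
    · exact Or.inl ⟨_, hz, upperPoint_phi_of_nonneg hI h⟩
    · refine Or.inr ⟨_, ⟨_, hz, rfl⟩, ?_⟩
      rw [← phi_conj, upperPoint_phi_of_nonneg (neg_mem_imUnits hI) (by simpa using h),
        Complex.conj_conj]
  · rintro z (⟨x, hx, rfl⟩ | ⟨_, ⟨x, hx, rfl⟩, rfl⟩)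
    · exact upperPoint_mem_profile hΩ hx
    · exact conj_mem_profile (upperPoint_mem_profile hΩ hx)

end Circular

/-! ### Slice functions off the real line -/

/-- `f` is induced on the circularization of `D` by `G`, a function into `ℝ_m ⊗ ℂ` written in
complex coordinates. -/
def IsSliceOn {m : ℕ} (D : Set ℂ) (f : Para m → Cl m) (G : ℂ → Finset (Fin m) → ℂ) : Prop :=
  ∀ z ∈ D, ∀ I ∈ imUnits m, f (phi I z) = sliceEval (toCl I) (G z)

theorem isInducedBy_iff {m : ℕ} {D : Set ℂ} {f : Para m → Cl m} {F : ℂ → Cl m × Cl m} :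
    IsInducedBy D f F ↔ IsSliceOn D f (stemCoord m ∘ F) := by
  simp only [IsInducedBy, IsSliceOn, Function.comp_apply, sliceEval_stemCoord]

/-- Off the real line, a slice function is as smooth as the function inducing it. -/
theorem contDiffAt_of_isSliceOn {m : ℕ} {D : Set ℂ} (hD : IsOpen D) (hDc : ∀ z ∈ D, conj z ∈ D)
    {n : WithTop ℕ∞} {f : Para m → Cl m} {G : ℂ → Finset (Fin m) → ℂ} (hf : IsSliceOn D f G)
    (hG : ContDiffOn ℝ n G D) {z : ℂ} (hz : z ∈ D) (hz0 : z.im ≠ 0) {I : Para m}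
    (hI : I ∈ imUnits m) : ContDiffAt ℝ n f (phi I z) := by
  -- `α + I β = α + (-I) (-β)`, so the point may be described by its upper half plane coordinate
  wlog hpos : 0 < z.im generalizing z I
  · rw [← phi_conj]
    have hneg : z.im < 0 := lt_of_le_of_ne (not_lt.1 hpos) hz0
    exact this (hDc z hz) (by simpa using hz0) (neg_mem_imUnits hI) (by simpa using hneg)
  set x := phi I z
  have hx : imPart x ≠ 0 := mt (imPart_phi_eq_zero_iff hI z).1 hz0
  have hux : upperPoint x = z := upperPoint_phi_of_nonneg hI hpos.le
  have hnorm : ContDiffAt ℝ n (fun y : Para m => ‖imPart y‖) x :=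
    ((imPartL m).contDiff.contDiffAt).norm ℝ hx
  have hup : ContDiffAt ℝ n (upperPoint : Para m → ℂ) x :=
    (Complex.ofRealCLM.contDiff.contDiffAt.comp x
      (EuclideanSpace.proj (0 : Fin (m + 1)) : Para m →L[ℝ] ℝ).contDiff.contDiffAt).add
      ((Complex.ofRealCLM.contDiff.contDiffAt.comp x hnorm).mul contDiffAt_const)
  have hdir : ContDiffAt ℝ n (fun y : Para m => toCl (imDir y)) x :=
    (toClL m).contDiff.contDiffAt.comp x
      ((hnorm.inv (norm_ne_zero_iff.2 hx)).smul (imPartL m).contDiff.contDiffAt)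
  have hGu : ContDiffAt ℝ n (fun y => (stemCoord m).symm (G (upperPoint y))) x := by
    refine (stemCoord m).symm.contDiff.contDiffAt.comp x (ContDiffAt.comp x ?_ hup)
    rw [hux]
    exact hG.contDiffAt (hD.mem_nhds hz)
  have hfin : ContDiffAt ℝ n (fun y => sliceEval (toCl (imDir y)) (G (upperPoint y))) x :=
    hGu.fst.add (((leftMul m).contDiff.contDiffAt.comp x hdir).clm_apply hGu.snd)
  refine hfin.congr_of_eventuallyEq ?_
  have h1 : ∀ᶠ y in nhds x, imPart y ≠ 0 := continuous_imPart.continuousAt.eventually_ne hx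
  have h2 : ∀ᶠ y in nhds x, upperPoint y ∈ D :=
    continuous_upperPoint.continuousAt.eventually_mem (by rw [hux]; exact hD.mem_nhds hz)
  filter_upwards [h1, h2] with y hy1 hy2
  rw [← hf _ hy2 _ (imDir_mem_imUnits hy1), phi_upperPoint_imDir hy1]

/-- At a non-real point `α + I β`, the operator `ϑ̄_m` differentiates along `ℂ_I` only. -/
theorem thetaBar_phi {m : ℕ} {g : Para m → Cl m} {I : Para m} (hI : I ∈ imUnits m) {z : ℂ}
    (hz : z.im ≠ 0) (hg : DifferentiableAt ℝ g (phi I z)) :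
    thetaBar g (phi I z) = crOp (toCl I) (g ∘ phi I) z := by
  have hc : HasFDerivAt (g ∘ phi I) (fderiv ℝ g (phi I z) ∘L phiL I) z :=
    hg.hasFDerivAt.comp z (phiL I).hasFDerivAt
  have hsum : ∑ h : Fin m, phi I z h.succ • fderiv ℝ g (phi I z) (unitVec h.succ) =
      z.im • fderiv ℝ g (phi I z) I := by
    have h0 : z.im • I = ∑ h : Fin m, phi I z h.succ • (unitVec h.succ : Para m) := by
      rw [← imPart_phi hI z]
      conv_lhs => rw [← (EuclideanSpace.basisFun (Fin (m + 1)) ℝ).sum_repr (imPart (phi I z))]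
      rw [Fin.sum_univ_succ]
      simp [imPart_zero_apply, imPart_succ, unitVec]
    rw [← map_smul, h0, map_sum]
    simp only [map_smul]
  rw [thetaBar, hsum, crOp, hc.fderiv, norm_imPart_phi hI, imPart_phi hI, toCl_smul, sq_abs]
  simp only [ContinuousLinearMap.comp_apply, phiL_apply, phi, Complex.one_re, Complex.one_im,
    Complex.I_re, Complex.I_im, one_smul, zero_smul, add_zero, zero_add, smul_smul,
    smul_mul_assoc, mul_smul_comm]
  rw [show z.im * ((z.im ^ 2)⁻¹ * z.im) = 1 by field_simp, one_smul]

/-- On slice functions, `ϑ̄_m` corresponds to the operator `∂/∂z̄` on stem functions. -/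
theorem isSliceOn_thetaBar_iterate {m : ℕ} {D : Set ℂ} (hD : IsOpen D)
    (hDc : ∀ z ∈ D, conj z ∈ D) (hD0 : ∀ z ∈ D, z.im ≠ 0) (n : ℕ) {f : Para m → Cl m}
    {G : ℂ → Finset (Fin m) → ℂ} (hf : IsSliceOn D f G) (hG : ContDiffOn ℝ n G D) :
    IsSliceOn D (thetaBar^[n] f) (wirtBar^[n] G) := by
  induction n generalizing f G with
  | zero => exact hf
  | succ n ih =>
    refine ih (fun z hz I hI => ?_) (contDiffOn_wirtBar hD hG)
    have hfd := (contDiffAt_of_isSliceOn hD hDc hf hG hz (hD0 z hz) hI).differentiableAt (by simp)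
    rw [thetaBar_phi hI (hD0 z hz) hfd]
    exact crOp_iterate_sliceEval (toCl_mul_self hI) hD 1
      (hG.of_le (by exact_mod_cast Nat.le_add_left 1 n)) (fun w hw => hf w hw I hI) hz

/-! ### Regularity at the real points -/

theorem exists_phi {m : ℕ} (hm : 0 < m) (x : Para m) :
    ∃ I ∈ imUnits m, ∃ z : ℂ, x = phi I z := by
  by_cases hx : imPart x = 0
  · obtain ⟨I, hI⟩ := imUnits_nonempty hm
    refine ⟨I, hI, (x 0 : ℂ), ?_⟩
    rw [imPart, sub_eq_zero] at hx
    simpa [phi] using hx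
  · exact ⟨_, imDir_mem_imUnits hx, _, (phi_upperPoint_imDir hx).symm⟩

theorem norm_phi {m : ℕ} {I : Para m} (hI : I ∈ imUnits m) (z : ℂ) : ‖phi I z‖ = ‖z‖ := by
  obtain ⟨h0, h1⟩ := (mem_imUnits_iff I).1 hI
  rw [← sq_eq_sq₀ (norm_nonneg _) (norm_nonneg _), EuclideanSpace.norm_sq_eq, Fin.sum_univ_succ,
    phi_apply_zero hI, Complex.sq_norm, Complex.normSq_apply]
  have h : ∀ k : Fin m, phi I z k.succ = z.im * I k.succ := fun k => by simp [phi, unitVec]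
  simp only [h, Real.norm_eq_abs, sq_abs, mul_pow, ← Finset.mul_sum, h1]
  ring

theorem nontrivial_cl (m : ℕ) : Nontrivial (Cl m) :=
  (clCoord m).toEquiv.nontrivial

/-- The power series `∑ v ^ k a_k` in a paravector variable `v`, with right coefficients. -/
def paraSeries {m : ℕ} (a : ℕ → Cl m) : FormalMultilinearSeries ℝ (Para m) (Cl m) := fun k =>
  (ContinuousLinearMap.apply ℝ (Cl m) (a k)).compContinuousMultilinearMap
    ((ContinuousMultilinearMap.mkPiAlgebraFin ℝ k (Cl m →L[ℝ] Cl m)).compContinuousLinearMap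
      fun _ => leftMul m ∘L toClL m)

theorem paraSeries_apply {m : ℕ} (a : ℕ → Cl m) (k : ℕ) (v : Para m) :
    paraSeries a k (fun _ => v) = toCl v ^ k * a k := by
  simp [paraSeries, leftMul_iterate]

theorem norm_paraSeries_le {m : ℕ} (a : ℕ → Cl m) (k : ℕ) :
    ‖paraSeries a k‖ ≤ ‖a k‖ * ‖leftMul m ∘L toClL m‖ ^ k := by
  have := nontrivial_cl m
  have h1 : ‖ContinuousLinearMap.apply ℝ (Cl m) (a k)‖ ≤ ‖a k‖ :=
    ContinuousLinearMap.opNorm_le_bound _ (norm_nonneg _) fun T => by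
      rw [ContinuousLinearMap.apply_apply, mul_comm]
      exact T.le_opNorm _
  have h2 := ContinuousMultilinearMap.norm_compContinuousLinearMap_le
    (ContinuousMultilinearMap.mkPiAlgebraFin ℝ k (Cl m →L[ℝ] Cl m))
    (fun _ : Fin k => leftMul m ∘L toClL m)
  rw [ContinuousMultilinearMap.norm_mkPiAlgebraFin, one_mul, Finset.prod_const, Finset.card_univ,
    Fintype.card_fin] at h2
  exact (ContinuousLinearMap.norm_compContinuousMultilinearMap_le _ _).trans
    (mul_le_mul h1 h2 (norm_nonneg _) (norm_nonneg _))

/-- The coefficients of a stem function at a real point may be taken invariant under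
conjugation. -/
theorem exists_real_coefficients {m : ℕ} {D : Set ℂ} (hD : IsOpen D)
    {G : ℂ → Finset (Fin m) → ℂ} (hG : DifferentiableOn ℂ G D)
    (hs : ∀ z ∈ D, G (conj z) = star (G z)) {r : ℝ} (hr : (r : ℂ) ∈ D) :
    ∃ (a : ℕ → Cl m) (ρ C : ℝ), 0 < ρ ∧ (∀ k, ‖a k‖ * ρ ^ k ≤ C) ∧
      Metric.ball (r : ℂ) ρ ⊆ D ∧ ∀ z ∈ Metric.ball (r : ℂ) ρ, ∀ I ∈ imUnits m,
        HasSum (fun k => toCl (phi I (z - r)) ^ k * a k) (sliceEval (toCl I) (G z)) := by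
  obtain ⟨R, hR, hRD⟩ := Metric.isOpen_iff.1 hD _ hr
  obtain ⟨q, R', hq⟩ := hG.analyticAt (hD.mem_nhds hr)
  obtain ⟨ρ, hρ0, hρ⟩ : ∃ ρ : NNReal, 0 < ρ ∧ (ρ : ENNReal) < min R' (ENNReal.ofReal R) := by
    obtain ⟨ρ, h1, h2⟩ := ENNReal.lt_iff_exists_nnreal_btwn.1
      (lt_min hq.r_pos (ENNReal.ofReal_pos.2 hR))
    exact ⟨ρ, by exact_mod_cast h1, h2⟩
  have hρR : (ρ : ℝ) < R := by
    have := hρ.trans_le (min_le_right _ _)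
    rwa [← ENNReal.ofReal_coe_nnreal, ENNReal.ofReal_lt_ofReal_iff hR] at this
  have hsub : Metric.ball (r : ℂ) ρ ⊆ D := (Metric.ball_subset_ball hρR.le).trans hRD
  obtain ⟨C, -, hC⟩ := q.norm_mul_pow_le_of_lt_radius
    ((hρ.trans_le (min_le_left _ _)).trans_le hq.r_le)
  have hsum : ∀ z ∈ Metric.ball (r : ℂ) ρ, HasSum (fun k => (z - r) ^ k • q.coeff k) (G z) := by
    intro z hz
    have hz' : z ∈ Metric.eball (r : ℂ) R' := by
      refine Metric.eball_subset_eball (hρ.le.trans (min_le_left _ _)) ?_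
      rwa [Metric.eball_coe]
    simpa [FormalMultilinearSeries.apply_eq_pow_smul_coeff] using hq.hasSum_sub hz'
  let d : ℕ → Finset (Fin m) → ℂ := fun k => (1 / 2 : ℝ) • (q.coeff k + star (q.coeff k))
  have hd : ∀ k, star (d k) = d k := fun k => by
    simp only [d, star_smul, star_add, star_star, star_trivial, add_comm]
  have hdnorm : ∀ k, ‖d k‖ ≤ ‖q.coeff k‖ := fun k => by
    have := norm_add_le (q.coeff k) (star (q.coeff k))
    rw [norm_star] at this
    simp only [d, norm_smul]
    norm_num
    linarith
  have hdsum : ∀ z ∈ Metric.ball (r : ℂ) ρ, HasSum (fun k => (z - r) ^ k • d k) (G z) := by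
    intro z hz
    have h1 := hsum z hz
    have h2 := (hsum (conj z) (by
      rw [mem_ball_iff_norm] at hz ⊢
      rwa [← Complex.conj_ofReal, ← map_sub, Complex.norm_conj])).star
    rw [hs z (hsub hz), star_star] at h2
    convert (h1.add h2).const_smul (1 / 2 : ℝ) using 1
    · funext k
      simp only [d, star_smul, Complex.star_def, map_pow, map_sub, Complex.conj_conj,
        Complex.conj_ofReal]
      rw [smul_comm, smul_add]
    · module
  refine ⟨fun k => sliceEval 0 (d k), ρ, ‖(sliceEval 0 : (Finset (Fin m) → ℂ) →L[ℝ] Cl m)‖ * C,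
    hρ0, fun k => ?_, hsub, fun z hz I hI => ?_⟩
  · calc _ ≤ ‖(sliceEval 0 : (Finset (Fin m) → ℂ) →L[ℝ] Cl m)‖ * ‖q.coeff k‖ * (ρ : ℝ) ^ k := by
          gcongr
          exact ((sliceEval 0).le_opNorm _).trans (by gcongr; exact hdnorm k)
      _ ≤ _ := by
          rw [mul_assoc]
          gcongr
          simpa [FormalMultilinearSeries.norm_apply_eq_norm_coef] using hC k
  · have h := (hdsum z hz).mapL (sliceEval (toCl I))
    simp only [sliceEval_pow_smul hI] at h
    simpa only [sliceEval_eq_of_star_eq (hd _) (toCl I) 0] using h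

/-- At a real point a slice function with holomorphic stem is the sum of a power series in a
paravector variable; hence it is analytic there. -/
theorem analyticAt_of_isSliceOn {m : ℕ} (hm : 0 < m) {D : Set ℂ} (hD : IsOpen D)
    {G : ℂ → Finset (Fin m) → ℂ} (hG : DifferentiableOn ℂ G D)
    (hs : ∀ z ∈ D, G (conj z) = star (G z)) {f : Para m → Cl m} (hf : IsSliceOn D f G) {r : ℝ}
    (hr : (r : ℂ) ∈ D) : AnalyticAt ℝ f (r • unitVec 0) := by
  obtain ⟨a, ρ, C, hρ, haC, hsub, hsum⟩ := exists_real_coefficients hD hG hs hr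
  set L := leftMul m ∘L toClL m
  -- the factor absorbs the norm of the multiplication of `ℝ_m`
  let δ : NNReal := ⟨ρ / (‖L‖ + 1), by positivity⟩
  have hδ : ‖L‖ * (δ : ℝ) ≤ ρ := by
    change ‖L‖ * (ρ / (‖L‖ + 1)) ≤ ρ
    rw [← mul_div_assoc, div_le_iff₀ (by positivity)]
    nlinarith [norm_nonneg L]
  have hrad : (δ : ENNReal) ≤ (paraSeries a).radius := by
    refine (paraSeries a).le_radius_of_bound C fun k => ?_
    calc _ ≤ ‖a k‖ * ‖L‖ ^ k * (δ : ℝ) ^ k := by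
          gcongr
          exact norm_paraSeries_le a k
      _ = ‖a k‖ * (‖L‖ * δ) ^ k := by rw [mul_pow, mul_assoc]
      _ ≤ ‖a k‖ * ρ ^ k := by gcongr
      _ ≤ C := haC k
  have hδ0 : (0 : NNReal) < δ := by
    change (0 : ℝ) < ρ / (‖L‖ + 1)
    positivity
  have hps := (paraSeries a).hasFPowerSeriesOnBall
    (lt_of_lt_of_le (by exact_mod_cast hδ0) hrad)
  have han : AnalyticAt ℝ (fun y : Para m => (paraSeries a).sum (y - r • unitVec 0))
      (r • unitVec 0) := by
    refine AnalyticAt.fun_comp (g := (paraSeries a).sum) ?_ (by fun_prop)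
    rw [sub_self]
    exact hps.analyticAt
  refine han.congr ?_
  filter_upwards [Metric.ball_mem_nhds (r • unitVec 0 : Para m) hρ] with y hy
  obtain ⟨I, hI, z, rfl⟩ := exists_phi hm y
  have hsub' : phi I z - r • unitVec 0 = phi I (z - r) := by
    simp only [phi, Complex.sub_re, Complex.sub_im, Complex.ofReal_re, Complex.ofReal_im,
      sub_zero, sub_smul]
    abel
  have hz : z ∈ Metric.ball (r : ℂ) ρ := by
    rw [mem_ball_iff_norm, hsub', norm_phi hI] at hy
    exact mem_ball_iff_norm.2 hy
  rw [hf z (hsub hz) I hI, ← (hsum z hz I hI).tsum_eq, hsub', FormalMultilinearSeries.sum]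
  simp only [paraSeries_apply]

/-- A slice function on a circular open set with holomorphic stem is slice monogenic. -/
theorem isSliceMonogenic_of_isSliceOn {m : ℕ} (hm : 0 < m) {Ω : Set (Para m)} (hΩ : IsOpen Ω)
    (hc : IsCircular Ω) {G : ℂ → Finset (Fin m) → ℂ} (hG : DifferentiableOn ℂ G (profile Ω))
    (hs : ∀ z ∈ profile Ω, G (conj z) = star (G z)) {f : Para m → Cl m}
    (hf : IsSliceOn (profile Ω) f G) : IsSliceMonogenic Ω f := by
  have hD := isOpen_profile hΩ
  have hGr : ContDiffOn ℝ 1 G (profile Ω) := (hG.contDiffOn hD).restrict_scalars ℝ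
  refine ⟨fun x hx => ContDiffAt.contDiffWithinAt ?_, ?_⟩
  · obtain ⟨z, hz, I, hI, rfl⟩ := exists_phi_of_mem hc hx
    by_cases h0 : z.im = 0
    · have hzr : (z.re : ℂ) = z := Complex.ext (by simp) (by simp [h0])
      have := (analyticAt_of_isSliceOn hm hD hG hs hf (r := z.re) (by rwa [hzr])).contDiffAt
        (n := 1)
      simpa [phi, h0] using this
    · exact contDiffAt_of_isSliceOn hD (fun _ => conj_mem_profile) hf hGr hz h0 hI
  · rintro I hI x ⟨hx, z, rfl⟩
    have hz : z ∈ profile Ω := ⟨I, hI, hx⟩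
    rw [debar, phiInv_phi hI, crOp_iterate_sliceEval (toCl_mul_self hI) hD 1
      (by exact_mod_cast hGr) (h := f ∘ phi I) (fun w hw => hf w hw I hI) hz]
    simp [wirtBar_eq_zero (hG.differentiableAt (hD.mem_nhds hz))]

/-- The slice function induced by `G`, read off the closed upper half plane. At a real point
`imDir x = 0`, which is harmless because the stem is invariant under conjugation there. -/
def sliceFun {m : ℕ} (G : ℂ → Finset (Fin m) → ℂ) (x : Para m) : Cl m :=
  sliceEval (toCl (imDir x)) (G (upperPoint x))

theorem isSliceOn_sliceFun {m : ℕ} {D : Set ℂ}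
    {G : ℂ → Finset (Fin m) → ℂ} (hs : ∀ z ∈ D, G (conj z) = star (G z)) :
    IsSliceOn D (sliceFun G) G := by
  intro z hz I hI
  rcases lt_trichotomy z.im 0 with h | h | h
  · have hu : upperPoint (phi I z) = conj z := by
      rw [← phi_conj, upperPoint_phi_of_nonneg (neg_mem_imUnits hI) (by simpa using h.le)]
    have hd : imDir (phi I z) = -I := by
      rw [imDir, norm_imPart_phi hI, imPart_phi hI, abs_of_neg h, inv_neg, neg_smul, smul_smul,
        inv_mul_cancel₀ h.ne, one_smul]
    rw [sliceFun, hu, hd, hs z hz, toCl_neg, sliceEval_neg_star]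
  · have hu : upperPoint (phi I z) = z := upperPoint_phi_of_nonneg hI h.ge
    have hzc : conj z = z := Complex.conj_eq_iff_im.2 h
    rw [sliceFun, hu]
    exact sliceEval_eq_of_star_eq (by rw [← hs z hz, hzc]) _ _
  · have hu : upperPoint (phi I z) = z := upperPoint_phi_of_nonneg hI h.le
    have hd : imDir (phi I z) = I := by
      rw [imDir, norm_imPart_phi hI, imPart_phi hI, abs_of_pos h, smul_smul,
        inv_mul_cancel₀ h.ne', one_smul]
    rw [sliceFun, hu, hd]

/-! ### The representation formula -/

/-- The value of a stem is determined by the values of its slice function at the two points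
`α + J β` and `α - J β`. -/
theorem sliceLift_add_star {m : ℕ} {J : Cl m} (hJ : J * J = -1) (v : Finset (Fin m) → ℂ) :
    sliceLift J (sliceEval J v) + star (sliceLift J (sliceEval J (star v))) = v := by
  apply (stemCoord m).symm.injective
  simp only [map_add, stemCoord_symm_star, sliceLift_apply, sliceEval_apply,
    ContinuousLinearEquiv.symm_apply_apply]
  apply Prod.ext
  · simp only [Prod.fst_add, Prod.smul_fst, mul_neg]
    module
  · simp only [Prod.snd_add, Prod.smul_snd, mul_neg, ← mul_assoc, hJ, neg_mul, one_mul]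
    module

theorem sliceEval_lift_add_star {m : ℕ} (J K c : Cl m) :
    sliceEval K (sliceLift J c + star (sliceLift J c)) = c := by
  rw [sliceLift_apply, Prod.smul_mk, ← stemCoord_conj, ← map_add, sliceEval_stemCoord]
  simp only [Prod.fst_add, Prod.snd_add, add_neg_cancel, mul_zero, add_zero]
  module

/-- Holomorphy is preserved by the reflection `G ↦ conj ∘ G ∘ conj`. -/
theorem differentiableOn_star_conj {ι : Type*} [Fintype ι] {D : Set ℂ} (hD : IsOpen D)
    (hDc : ∀ z ∈ D, conj z ∈ D) {G : ℂ → ι → ℂ} (hG : DifferentiableOn ℂ G D) :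
    DifferentiableOn ℂ (fun z => star (G (conj z))) D := fun z hz => by
  have h := (hG.differentiableAt (hD.mem_nhds (hDc z hz))).star_star
  rw [← Complex.star_def, star_star] at h
  exact h.differentiableWithinAt

/-- On a circular domain meeting the real line, slice monogenic functions are slice functions with
holomorphic stem. The stem is built from one slice by the representation formula; on any other
slice, the function it induces coincides with the given one on the real points of the domain,
hence everywhere, by the identity theorem. -/
theorem exists_stem_of_isSliceMonogenic {m : ℕ} (hm : 0 < m) {Ω : Set (Para m)} (hΩ : IsOpen Ω)
    (hconn : IsPreconnected Ω) (hc : IsCircular Ω) (hreal : (Ω ∩ realLine m).Nonempty)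
    {f : Para m → Cl m} (hf : IsSliceMonogenic Ω f) :
    ∃ G : ℂ → Finset (Fin m) → ℂ, DifferentiableOn ℂ G (profile Ω) ∧
      (∀ z ∈ profile Ω, G (conj z) = star (G z)) ∧ IsSliceOn (profile Ω) f G := by
  obtain ⟨J, hJ⟩ := imUnits_nonempty hm
  have hD := isOpen_profile hΩ
  have hDc : ∀ z ∈ profile Ω, conj z ∈ profile Ω := fun _ => conj_mem_profile
  have hH : ∀ I ∈ imUnits m,
      DifferentiableOn ℂ (sliceLift (toCl I) ∘ f ∘ phi I) (profile Ω) := by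
    intro I hI z hz
    have hx := phi_mem_of_mem_profile hc hz hI
    have hd : DifferentiableAt ℝ (f ∘ phi I) z :=
      ((hf.1.differentiableOn (by simp)).differentiableAt (hΩ.mem_nhds hx)).comp z
        (phiL I).differentiableAt
    have h0 := hf.2 I hI _ ⟨hx, z, rfl⟩
    rw [debar, phiInv_phi hI] at h0
    exact (differentiableAt_sliceLift (toCl_mul_self hI) hd h0).differentiableWithinAt
  let H := sliceLift (toCl J) ∘ f ∘ phi J
  let G : ℂ → Finset (Fin m) → ℂ := fun z => H z + star (H (conj z))
  have hG : DifferentiableOn ℂ G (profile Ω) :=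
    (hH J hJ).add (differentiableOn_star_conj hD hDc (hH J hJ))
  refine ⟨G, hG, fun z _ => ?_, fun z hz I hI => ?_⟩
  · simp only [G, Complex.conj_conj, star_add, star_star, add_comm]
  have hGI : DifferentiableOn ℂ (sliceLift (toCl I) ∘ sliceEval (toCl I) ∘ G) (profile Ω) := by
    intro w hw
    have hGw := hG.differentiableAt (hD.mem_nhds hw)
    have hGr : DifferentiableAt ℝ G w := hGw.restrictScalars ℝ
    refine (differentiableAt_sliceLift (toCl_mul_self hI)
      ((sliceEval (toCl I)).differentiableAt.comp w hGr) ?_).differentiableWithinAt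
    rw [crOp_sliceEval (toCl_mul_self hI) hGr, wirtBar_eq_zero hGw, map_zero]
  have hagree : ∀ r : ℝ, f (phi I r) = sliceEval (toCl I) (G r) := by
    intro r
    have h : phi I (r : ℂ) = phi J (r : ℂ) := by simp [phi]
    simp only [G, Complex.conj_ofReal, H, Function.comp_apply]
    rw [sliceEval_lift_add_star, h]
  obtain ⟨p, hp, hp0⟩ := id hreal
  have hpr : (p 0 : ℂ) ∈ profile Ω := by
    have hp0 : imPart p = 0 := hp0
    simpa [upperPoint, hp0] using upperPoint_mem_profile hc hp
  have hfreq : ∃ᶠ w in nhdsWithin (p 0 : ℂ) {(p 0 : ℂ)}ᶜ,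
      (sliceLift (toCl I) ∘ f ∘ phi I) w = (sliceLift (toCl I) ∘ sliceEval (toCl I) ∘ G) w := by
    have ht : Filter.Tendsto (fun r : ℝ => (r : ℂ)) (nhdsWithin (p 0) {p 0}ᶜ)
        (nhdsWithin (p 0 : ℂ) {(p 0 : ℂ)}ᶜ) :=
      Complex.continuous_ofReal.continuousWithinAt.tendsto_nhdsWithin fun r hr => by
        simpa using hr
    refine ht.frequently (Filter.Eventually.frequently (Filter.Eventually.of_forall fun r => ?_))
    simp only [Function.comp_apply, hagree]
  have heq := ((hH I hI).analyticOnNhd hD).eqOn_of_preconnected_of_frequently_eq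
    (hGI.analyticOnNhd hD) (isPreconnected_profile hc hconn hreal) hpr hfreq hz
  have := congrArg (sliceEval (toCl I)) heq
  simpa only [Function.comp_apply, sliceEval_sliceLift (toCl_mul_self hI)] using this

/-! ### Slice functions and polynomials in the conjugate variable -/

theorem sliceEval_conj_polynomial {m : ℕ} {I : Para m} (hI : I ∈ imUnits m) (n : ℕ) (z : ℂ)
    (g : ℕ → Finset (Fin m) → ℂ) :
    sliceEval (toCl I) (∑ k ∈ Finset.range n, conj z ^ k • g k) =
      ∑ h : Fin n, toCl (conjPara (phi I z)) ^ (h : ℕ) * sliceEval (toCl I) (g h) := by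
  rw [map_sum, Finset.sum_range, conjPara_phi hI]
  exact Finset.sum_congr rfl fun k _ => sliceEval_pow_smul hI _ _ _

/-- The stem of a global slice polymonogenic function is a polynomial in `z̄` whose coefficients
are holomorphic stem functions. -/
theorem exists_stem_of_isGlobalSlicePolymonogenic {m : ℕ} (hm : 0 < m) {Ω : Set (Para m)}
    (hΩ : IsOpen Ω) (hconn : IsPreconnected Ω) (hc : IsCircular Ω)
    (hreal : (Ω ∩ realLine m).Nonempty) {n : ℕ} {f : Para m → Cl m}
    (hf : IsGlobalSlicePolymonogenic n Ω f) :
    ∃ F : ℂ → Cl m × Cl m, IsStem (profile Ω) F ∧ ContDiffOn ℝ n F (profile Ω) ∧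
      IsInducedBy (profile Ω) f F ∧ IsInducedBy (profile Ω) 0 (stemDebar^[n] F) := by
  obtain ⟨fh, hfh, hsum⟩ := hf
  choose G hG hGs hGf using fun h =>
    exists_stem_of_isSliceMonogenic hm hΩ hconn hc hreal (hfh h)
  have hD := isOpen_profile hΩ
  let g : ℕ → ℂ → Finset (Fin m) → ℂ := fun k => if h : k < n then G ⟨k, h⟩ else 0
  have hgfin : ∀ h : Fin n, g h = G h := fun h => by simp [g]
  have hg : ∀ k, DifferentiableOn ℂ (g k) (profile Ω) := fun k => by
    by_cases h : k < n
    · simpa [g, h] using hG ⟨k, h⟩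
    · simp [g, h]
  have hgs : ∀ k, ∀ z ∈ profile Ω, g k (conj z) = star (g k z) := fun k z hz => by
    by_cases h : k < n
    · simpa [g, h] using hGs ⟨k, h⟩ z hz
    · simp [g, h]
  let P : ℂ → Finset (Fin m) → ℂ := fun z => ∑ k ∈ Finset.range n, conj z ^ k • g k z
  have hPF : stemCoord m ∘ ((stemCoord m).symm ∘ P) = P := by
    funext z
    simp
  have hPsmooth : ContDiffOn ℝ n P (profile Ω) := by
    refine ContDiffOn.sum fun k _ => ?_
    have h1 : ContDiffOn ℝ n (fun z : ℂ => conj z ^ k) (profile Ω) :=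
      (Complex.conjCLE.contDiff.pow k).contDiffOn
    exact h1.smul (((hg k).contDiffOn hD).restrict_scalars ℝ)
  refine ⟨(stemCoord m).symm ∘ P, ?_, (stemCoord m).symm.contDiff.comp_contDiffOn hPsmooth, ?_, ?_⟩
  · refine isStem_iff.2 fun z hz => ?_
    simp only [Function.comp_apply, ContinuousLinearEquiv.apply_symm_apply, P, star_sum,
      star_smul, hgs _ z hz, Complex.star_def, map_pow]
  · rw [isInducedBy_iff, hPF]
    intro z hz I hI
    rw [hsum _ (phi_mem_of_mem_profile hc hz hI), sliceEval_conj_polynomial hI]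
    refine Finset.sum_congr rfl fun h _ => ?_
    rw [hGf h z hz I hI, hgfin]
  · rw [isInducedBy_iff, stemCoord_stemDebar_iterate, hPF]
    intro z hz I _
    rw [wirtBar_iterate_conj_polynomial hD n g hg z hz, map_zero]
    rfl

/-- A slice function whose stem has the regularity of the structure theorem for polyanalytic
functions, and is annihilated by `ϑ̄_m^n` off the real line, is global slice polymonogenic. -/
theorem isGlobalSlicePolymonogenic_of_thetaBar {m : ℕ} (hm : 0 < m) {Ω : Set (Para m)}
    (hΩ : IsOpen Ω) (hc : IsCircular Ω) {n : ℕ} {f : Para m → Cl m}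
    (hf : IsSliceOfClass n Ω f) (hsmooth : ContDiffOn ℝ (n + 1 : ℕ) f (Ω \ realLine m))
    (h0 : ∀ x ∈ Ω \ realLine m, thetaBar^[n + 1] f x = 0) :
    IsGlobalSlicePolymonogenic (n + 1) Ω f := by
  obtain ⟨F, hstem, hF, hind⟩ := hf
  rw [isStem_iff] at hstem
  rw [isInducedBy_iff] at hind
  obtain ⟨J, hJ⟩ := imUnits_nonempty hm
  have hD := isOpen_profile hΩ
  set G := stemCoord m ∘ F
  set D := profile Ω
  have hDc : ∀ z ∈ D, conj z ∈ D := fun _ => conj_mem_profile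
  have hGsmooth : ContDiffOn ℝ n G D := (stemCoord m).contDiff.comp_contDiffOn hF
  have hD' : IsOpen (D \ {z : ℂ | z.im = 0}) :=
    hD.sdiff (isClosed_eq Complex.continuous_im continuous_const)
  have hDc' : ∀ z ∈ D \ {z : ℂ | z.im = 0}, conj z ∈ D \ {z : ℂ | z.im = 0} := fun z hz =>
    ⟨hDc z hz.1, by simpa using hz.2⟩
  have hmem : ∀ z ∈ D \ {z : ℂ | z.im = 0}, ∀ I ∈ imUnits m, phi I z ∈ Ω \ realLine m :=
    fun z hz I hI => ⟨phi_mem_of_mem_profile hc hz.1 hI,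
      fun h => hz.2 ((imPart_phi_eq_zero_iff hI z).1 h)⟩
  -- off the real line the stem inherits the regularity of `f` by the representation formula
  have hGsmooth' : ContDiffOn ℝ (n + 1 : ℕ) G (D \ {z | z.im = 0}) := by
    have h1 : ContDiffOn ℝ (n + 1 : ℕ) (fun z => sliceLift (toCl J) (f (phi J z)))
        (D \ {z | z.im = 0}) :=
      (sliceLift (toCl J)).contDiff.comp_contDiffOn
        (hsmooth.comp (phiL J).contDiff.contDiffOn fun z hz => hmem z hz J hJ)
    have h2 : ContDiffOn ℝ (n + 1 : ℕ) (fun z => star (sliceLift (toCl J) (f (phi J (conj z)))))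
        (D \ {z | z.im = 0}) :=
      (starL' ℝ : (Finset (Fin m) → ℂ) ≃L[ℝ] (Finset (Fin m) → ℂ)).contDiff.comp_contDiffOn
        (h1.comp Complex.conjCLE.contDiff.contDiffOn fun z hz => hDc' z hz)
    refine (h1.add h2).congr fun z hz => ?_
    rw [hind z hz.1 J hJ, hind _ (hDc z hz.1) J hJ]
    change G z = sliceLift (toCl J) (sliceEval (toCl J) (G z)) +
      star (sliceLift (toCl J) (sliceEval (toCl J) (G (conj z))))
    rw [show G (conj z) = star (G z) from hstem z hz.1, sliceLift_add_star (toCl_mul_self hJ)]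
  have hzero : ∀ z ∈ D \ {z : ℂ | z.im = 0}, wirtBar^[n + 1] G z = 0 := by
    intro z hz
    have h := isSliceOn_thetaBar_iterate hD' hDc' (fun z hz => hz.2) (n + 1)
      (fun w hw I hI => hind w hw.1 I hI) hGsmooth' z hz
    have h1 := h J hJ
    have h2 := h _ (neg_mem_imUnits hJ)
    rw [h0 _ (hmem z hz _ hJ)] at h1
    rw [h0 _ (hmem z hz _ (neg_mem_imUnits hJ)), toCl_neg] at h2
    exact eq_zero_of_sliceEval_eq_zero (toCl_mul_self hJ) h1.symm h2.symm
  obtain ⟨g, hg, hsum⟩ := exists_conj_polynomial hD n hGsmooth hGsmooth' hzero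
  -- the coefficients are made into stem functions by averaging with their reflections
  let s : ℕ → ℂ → Finset (Fin m) → ℂ := fun k z => (1 / 2 : ℂ) • (g k z + star (g k (conj z)))
  have hs : ∀ k, DifferentiableOn ℂ (s k) D := fun k =>
    ((hg k).add (differentiableOn_star_conj hD hDc (hg k))).const_smul (1 / 2 : ℂ)
  have hss : ∀ k, ∀ z ∈ D, s k (conj z) = star (s k z) := fun k z _ => by
    simp [s, add_comm]
  have hGs : ∀ z ∈ D, G z = ∑ k ∈ Finset.range (n + 1), conj z ^ k • s k z := by
    intro z hz
    have h1 := hsum z hz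
    have h2 : G z = ∑ k ∈ Finset.range (n + 1), conj z ^ k • star (g k (conj z)) := by
      have h3 : G (conj z) = star (G z) := hstem z hz
      rw [← star_star (G z), ← h3, hsum _ (hDc z hz)]
      simp [star_sum]
    have h4 : G z = (1 / 2 : ℂ) • (G z + G z) := by module
    rw [h4]
    nth_rewrite 1 [h1]
    rw [h2, ← Finset.sum_add_distrib, Finset.smul_sum]
    refine Finset.sum_congr rfl fun k _ => ?_
    rw [← smul_add, smul_comm]
  have hslice : ∀ k, IsSliceOn D (sliceFun (s k)) (s k) := fun k => isSliceOn_sliceFun (hss k)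
  refine ⟨fun k => sliceFun (s k),
    fun k => isSliceMonogenic_of_isSliceOn hm hΩ hc (hs k) (hss k) (hslice k), fun x hx => ?_⟩
  obtain ⟨z, hz, I, hI, rfl⟩ := exists_phi_of_mem hc hx
  rw [hind z hz I hI, hGs z hz, sliceEval_conj_polynomial hI]
  exact Finset.sum_congr rfl fun k _ => by rw [← hslice k z hz I hI]

/-- On a slice, `∂̄_I^n` corresponds to the `n`-th power of `∂/∂z̄` on stem functions. -/
theorem debar_phi {m : ℕ} {D : Set ℂ} (hD : IsOpen D) {n : ℕ} {f : Para m → Cl m}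
    {F : ℂ → Cl m × Cl m} (hF : ContDiffOn ℝ n F D) (hf : IsInducedBy D f F) {z : ℂ} (hz : z ∈ D)
    {I : Para m} (hI : I ∈ imUnits m) :
    debar I n f (phi I z) = sliceEval (toCl I) (wirtBar^[n] (stemCoord m ∘ F) z) := by
  rw [debar, phiInv_phi hI]
  exact crOp_iterate_sliceEval (toCl_mul_self hI) hD n
    ((stemCoord m).contDiff.comp_contDiffOn hF)
    (fun w hw => isInducedBy_iff.1 hf w hw I hI) hz

/-- Off the real line, the operators `∂̄_I^n` and `ϑ̄_m^n` agree on slice functions of class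
`C^n`. -/
theorem thetaBar_iterate_phi {m : ℕ} {Ω : Set (Para m)} (hΩ : IsOpen Ω) {n : ℕ}
    {f : Para m → Cl m} (hf : IsSliceOfClass n Ω f) {z : ℂ} (hz : z ∈ profile Ω)
    (hz0 : z.im ≠ 0) {I : Para m} (hI : I ∈ imUnits m) :
    thetaBar^[n] f (phi I z) = debar I n f (phi I z) := by
  obtain ⟨F, -, hF, hind⟩ := hf
  have hD := isOpen_profile hΩ
  rw [debar_phi hD hF hind hz hI]
  refine isSliceOn_thetaBar_iterate (D := profile Ω \ {z | z.im = 0})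
    (hD.sdiff (isClosed_eq Complex.continuous_im continuous_const))
    (fun w hw => ⟨conj_mem_profile hw.1, by simpa using hw.2⟩) (fun w hw => hw.2) n
    (fun w hw => isInducedBy_iff.1 hind w hw.1)
    (((stemCoord m).contDiff.comp_contDiffOn hF).mono Set.sdiff_subset) z ⟨hz, hz0⟩ I hI

/-- Off the real line, a slice function of class `C^n` is a function of class `C^n`. -/
theorem contDiffOn_of_isSliceOfClass {m : ℕ} {Ω : Set (Para m)} (hΩ : IsOpen Ω)
    (hc : IsCircular Ω) {n : ℕ} {f : Para m → Cl m} (hf : IsSliceOfClass n Ω f) :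
    ContDiffOn ℝ n f (Ω \ realLine m) := by
  obtain ⟨F, -, hF, hind⟩ := hf
  rintro x ⟨hx, hx0⟩
  obtain ⟨z, hz, I, hI, rfl⟩ := exists_phi_of_mem hc hx
  exact (contDiffAt_of_isSliceOn (isOpen_profile hΩ) (fun _ => conj_mem_profile)
    (isInducedBy_iff.1 hind) ((stemCoord m).contDiff.comp_contDiffOn hF) hz
    (fun h => hx0 ((imPart_phi_eq_zero_iff hI z).2 h)) hI).contDiffWithinAt

end

end SliceClifford

theorem mainTheorem8 (m : ℕ) (hm : 2 ≤ m) (Ω : Set (Para m)) (hΩopen : IsOpen Ω)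
    (hΩconn : IsConnected Ω) (hΩcirc : IsCircular Ω) (hΩreal : (Ω ∩ realLine m).Nonempty)
    (n : ℕ) (hn : 1 ≤ n) (f : Para m → Cl m) :
    List.TFAE [
      IsGlobalSlicePolymonogenic n Ω f,
      IsSliceOfClass (n - 1) Ω f ∧ ContDiffOn ℝ n f (Ω \ realLine m) ∧
        ∀ x ∈ Ω \ realLine m, thetaBar^[n] f x = 0,
      IsSliceOfClass n Ω f ∧
        ∀ I ∈ imUnits m, ∀ x ∈ Ω ∩ slicePlane I, debar I n f x = 0,
      IsSliceOfClass n Ω f ∧ ∀ x ∈ Ω \ realLine m, thetaBar^[n] f x = 0,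
      IsSliceOfClass n Ω f ∧ IsSliceDerivPow n Ω f 0] := by
  have hm0 : 0 < m := by omega
  tfae_have 1 → 5 := fun h => by
    obtain ⟨F, h1, h2, h3, h4⟩ := exists_stem_of_isGlobalSlicePolymonogenic hm0 hΩopen
      hΩconn.isPreconnected hΩcirc hΩreal h
    exact ⟨⟨F, h1, h2, h3⟩, F, h1, h2, h3, h4⟩
  tfae_have 5 → 3 := by
    rintro ⟨h, F, -, hF, hind, h0⟩
    refine ⟨h, ?_⟩
    rintro I hI x ⟨hx, z, rfl⟩
    have hz : z ∈ profile Ω := ⟨I, hI, hx⟩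
    rw [isInducedBy_iff, stemCoord_stemDebar_iterate] at h0
    rw [debar_phi (isOpen_profile hΩopen) hF hind hz hI, ← h0 z hz I hI]
    rfl
  tfae_have 3 → 4 := by
    rintro ⟨h, h0⟩
    refine ⟨h, ?_⟩
    rintro x ⟨hx, hx0⟩
    obtain ⟨z, hz, I, hI, rfl⟩ := exists_phi_of_mem hΩcirc hx
    rw [thetaBar_iterate_phi hΩopen h hz
      (fun h => hx0 ((imPart_phi_eq_zero_iff hI z).2 h)) hI]
    exact h0 I hI _ ⟨hx, z, rfl⟩
  tfae_have 4 → 2 := by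
    rintro ⟨h, h0⟩
    refine ⟨?_, contDiffOn_of_isSliceOfClass hΩopen hΩcirc h, h0⟩
    obtain ⟨F, h1, h2, h3⟩ := h
    exact ⟨F, h1, h2.of_le (by exact_mod_cast Nat.sub_le n 1), h3⟩
  tfae_have 2 → 1 := by
    rintro ⟨h, hsmooth, h0⟩
    obtain ⟨k, rfl⟩ := Nat.exists_eq_add_of_le' hn
    exact isGlobalSlicePolymonogenic_of_thetaBar hm0 hΩopen hΩcirc h hsmooth h0
  tfae_finish
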